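/- Let $G$ be a group. A hyperbolic $G$-space is a nonempty geodesic metric space that is Gromov hyperbolic (for some $\delta$, all fibres of the maps from geodesic triangles to their comparison tripods have diameter less than $\delta$), equipped with an isometric action of $G$. Two hyperbolic $G$-spaces are equivalent if they lie in the same class of the equivalence relation, on hyperbolic $G$-spaces, generated by the existence of a coarsely equivariant quasi-isometric embedding (a quasi-isometric embedding $f\colon X\to Y$ such that, for some $C$, $d(f(gx),gf(x))\le C$ for all $g\in G$, $x\in X$). The Gromov boundary $\partial X$ is the set of equivalence classes of sequences tending to infinity. Let $Y$ be a (nonempty) connected graph with a $G$-action, with vertex set $V$ and path metric $d_Y$. A sequence of maps $B_n\colon V\to 2^V$ ($n=1,2,\dots$) is admissible if for all $v,w\in V$, all $n\ge 1$ and all $g\in G$: $B_1(v)=\{w\in V\mid d_Y(v,w)\le 1\}$; if $v\in B_n(w)$ then $B_n(v)\subset B_{n+1}(w)$; if $v\in B_n(w)$ then $w\in B_n(v)$; and $gB_n(w)=B_n(gw)$. The combinatorial horoball $\mathcal H(Y,B_*)$ is the graph with vertex set $V\times\{1,2,\dots\}$, with an edge joining $(v,n)$ to $(v,n+1)$ for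 all $v$ and $n$, and an edge joining $(v,n)$ to $(w,n)$ whenever $v\in B_n(w)$ and $v\neq w$. It is regarded as a metric graph with edges of length $1$, with the induced action of $G$. Theorem. For every hyperbolic $G$-space $X$ the following three conditions are equivalent. (1) $X$ has an invariant horoball: $X$ is equivalent to a hyperbolic $G$-space of the form $\mathcal H(Y,B_*)$, for some connected graph $Y$ with a $G$-action and some admissible $B_*$. (2) $X$ is elementary (that is, $X$ is equivalent to the trivial $G$-space consisting of one point, or $G$ fixes a point of $\partial X$), and no element of $G$ acts hyperbolically on $X$ (an element $g$ acts hyperbolically if $n\mapsto g^n x$ is a quasi-isometric embedding of $\mathbb Z$ into $X$ for $x\in X$). (3) $X$ is equivalent to a hyperbolic $G$-space $Z$ such that $\partial Z$ has at most one point. -/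

import Mathlib

open Filter

universe u

namespace HoroEq

/-! ### Coarse geometry and Gromov hyperbolicity -/

/-- `f` is a `(K, C)`-quasi-isometric embedding. -/
def IsQIEmbedding {X Y : Type*} [MetricSpace X] [MetricSpace Y] (K C : ℝ) (f : X → Y) : Prop :=
  1 ≤ K ∧ 0 ≤ C ∧
    ∀ x₁ x₂, K⁻¹ * dist x₁ x₂ - C ≤ dist (f x₁) (f x₂) ∧
      dist (f x₁) (f x₂) ≤ K * dist x₁ x₂ + C

/-- `c`, restricted to `[0, d(x,y)]`, is a unit speed geodesic from `x` to `y`. -/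
def IsGeodesicFromTo {X : Type*} [MetricSpace X] (c : ℝ → X) (x y : X) : Prop :=
  c 0 = x ∧ c (dist x y) = y ∧
    ∀ s ∈ Set.Icc 0 (dist x y), ∀ t ∈ Set.Icc 0 (dist x y), dist (c s) (c t) = |s - t|

/-- Any two points are joined by a geodesic. -/
def IsGeodesicSpace (X : Type*) [MetricSpace X] : Prop :=
  ∀ x y : X, ∃ c : ℝ → X, IsGeodesicFromTo c x y

/-- The Gromov product `(x, y)_z`. -/
noncomputable def gromovProduct {X : Type*} [MetricSpace X] (x y z : X) : ℝ :=
  (dist x z + dist y z - dist x y) / 2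

/-- Every fibre of the map from any geodesic triangle to its comparison tripod has diameter less
than `δ`.  Two points on different sides of a triangle have the same image in the tripod exactly
when they lie on the two sides issuing from a common vertex `x`, at the same distance `s` from `x`,
where `s` is at most the length `(y, z)_x` of the leg of the tripod at `x`
(the case `s = (y, z)_x` being the fibre over the centre). -/
def HasThinTriangles (X : Type*) [MetricSpace X] (δ : ℝ) : Prop :=
  0 < δ ∧ ∀ (x y z : X) (c c' : ℝ → X), IsGeodesicFromTo c x y → IsGeodesicFromTo c' x z →
    ∀ s ∈ Set.Icc 0 (gromovProduct y z x), dist (c s) (c' s) < δ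

/-! ### Spaces with an isometric group action -/

/-- A metric space with an isometric action of `G`. -/
structure GSpace (G : Type u) [Group G] : Type (u + 1) where
  /-- the underlying set -/
  carrier : Type u
  [metric : MetricSpace carrier]
  [action : MulAction G carrier]
  [isometric : IsIsometricSMul G carrier]

attribute [instance] GSpace.metric GSpace.action GSpace.isometric

/-- The space is nonempty, geodesic and Gromov hyperbolic. -/
def GSpace.IsHyperbolic {G : Type u} [Group G] (X : GSpace G) : Prop :=
  Nonempty X.carrier ∧ IsGeodesicSpace X.carrier ∧ ∃ δ, HasThinTriangles X.carrier δ

/-- A hyperbolic `G`-space: a nonempty Gromov hyperbolic geodesic metric space with an isometric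
action of `G`. -/
structure HypGSpace (G : Type u) [Group G] : Type (u + 1) extends GSpace G where
  isHyperbolic : toGSpace.IsHyperbolic

/-- There is a coarsely equivariant quasi-isometric embedding of `X` into `Y`. -/
def CoarselyEmbeds {G : Type u} [Group G] (X Y : HypGSpace G) : Prop :=
  ∃ f : X.carrier → Y.carrier, (∃ K C, IsQIEmbedding K C f) ∧
    ∃ C : ℝ, ∀ (g : G) (x : X.carrier), dist (f (g • x)) (g • f x) ≤ C

/-- The equivalence relation on hyperbolic `G`-spaces generated by coarsely equivariant
quasi-isometric embeddings. -/
def Equivalent {G : Type u} [Group G] (X Y : HypGSpace G) : Prop :=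
  Relation.EqvGen CoarselyEmbeds X Y

/-- A single point, as a `G`-space. -/
def pointSpace (G : Type u) [Group G] : GSpace G where
  carrier := PUnit.{u + 1}
  isometric := ⟨fun _ => isometry_subsingleton⟩

/-- The trivial hyperbolic `G`-space consisting of a single point. -/
def point (G : Type u) [Group G] : HypGSpace G where
  toGSpace := pointSpace G
  isHyperbolic := by
    have hd : ∀ x y : (pointSpace G).carrier, dist x y = 0 := fun _ _ => rfl
    refine ⟨⟨PUnit.unit⟩, fun x y => ⟨fun _ => x, rfl, rfl, ?_⟩, 1, one_pos, ?_⟩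
    · intro s hs t ht
      rw [hd x y] at hs ht
      have h1 : s = 0 := le_antisymm hs.2 hs.1
      have h2 : t = 0 := le_antisymm ht.2 ht.1
      simp [h1, h2]
    · intro x y z c c' _ _ s _
      rw [hd]
      exact one_pos

/-! ### The Gromov boundary -/

/-- `(x_i, x_j)_p → ∞` as `i, j → ∞`, for every base point `p` (equivalently, for one). -/
def TendsToInfinity {X : Type*} [MetricSpace X] (x : ℕ → X) : Prop :=
  ∀ p : X, Tendsto (fun ij : ℕ × ℕ => gromovProduct (x ij.1) (x ij.2) p) atTop atTop

/-- `(x_i, y_j)_p → ∞` as `i, j → ∞`, for every base point `p` (equivalently, for one). -/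
def SeqEquiv {X : Type*} [MetricSpace X] (x y : ℕ → X) : Prop :=
  ∀ p : X, Tendsto (fun ij : ℕ × ℕ => gromovProduct (x ij.1) (y ij.2) p) atTop atTop

/-- The Gromov boundary: classes of sequences tending to infinity.  (In a Gromov hyperbolic space
`SeqEquiv` is an equivalence relation on these sequences.) -/
def Boundary (X : Type*) [MetricSpace X] : Type _ :=
  Quot (fun x y : {x : ℕ → X // TendsToInfinity x} => SeqEquiv x.1 y.1)

theorem gromovProduct_smul {G X : Type*} [Group G] [MetricSpace X] [MulAction G X]
    [IsIsometricSMul G X] (g : G) (x y p : X) :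
    gromovProduct (g • x) (g • y) p = gromovProduct x y (g⁻¹ • p) := by
  have h : ∀ z : X, dist (g • z) p = dist z (g⁻¹ • p) := fun z => by
    rw [← dist_smul g z (g⁻¹ • p), smul_inv_smul]
  simp only [gromovProduct, dist_smul, h]

/-- The action of `g` on the boundary, induced by `(x_i) ↦ (g x_i)`. -/
def Boundary.smul {G X : Type*} [Group G] [MetricSpace X] [MulAction G X]
    [IsIsometricSMul G X] (g : G) : Boundary X → Boundary X :=
  Quot.map
    (fun x => ⟨fun i => g • x.1 i, fun p => by
      simpa only [gromovProduct_smul] using x.2 (g⁻¹ • p)⟩)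
    (fun x y h p => by simpa only [gromovProduct_smul] using h (g⁻¹ • p))

/-! ### Elementary actions, hyperbolic elements -/

/-- The action is equivalent to the trivial action on a point, or it fixes a boundary point. -/
def IsElementary {G : Type u} [Group G] (X : HypGSpace G) : Prop :=
  Equivalent X (point G) ∨ ∃ ξ : Boundary X.carrier, ∀ g : G, Boundary.smul g ξ = ξ

/-- `n ↦ gⁿ x` is a quasi-isometric embedding of `ℤ` into `X`. -/
def ActsHyperbolically {G : Type u} [Group G] (X : HypGSpace G) (g : G) : Prop :=
  ∀ x : X.carrier, ∃ K C, IsQIEmbedding K C (fun n : ℤ => g ^ n • x)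

/-! ### Graphs with a group action and their geometric realizations -/

/-- A connected graph on which `G` acts. -/
structure GGraph (G : Type u) [Group G] : Type (u + 1) where
  /-- the vertex set -/
  vert : Type u
  [action : MulAction G vert]
  /-- the graph -/
  graph : SimpleGraph vert
  connected : graph.Connected
  smul_adj : ∀ (g : G) (v w : vert), graph.Adj v w → graph.Adj (g • v) (g • w)

attribute [instance] GGraph.action

/-- A parametrized point of the metric graph with edges of length one: the point at distance `t`
from `src` on the edge from `src` to `tgt`, or (if `src = tgt` and `t = 0`) a vertex. -/
structure GraphPoint {V : Type u} (Γ : SimpleGraph V) : Type u where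
  /-- the initial vertex of the oriented edge -/
  src : V
  /-- the terminal vertex of the oriented edge -/
  tgt : V
  /-- the distance from `src` -/
  t : ℝ
  nonneg : 0 ≤ t
  le_one : t ≤ 1
  adj : Γ.Adj src tgt ∨ (src = tgt ∧ t = 0)

namespace GraphPoint

variable {V : Type u} {Γ : SimpleGraph V}

/-- Length of a shortest path from `p` to `q` through an endpoint of the edge of `p` and an
endpoint of the edge of `q`. -/
noncomputable def vertexDist (p q : GraphPoint Γ) : ℝ :=
  min (min (p.t + Γ.dist p.src q.src + q.t) (p.t + Γ.dist p.src q.tgt + (1 - q.t)))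
    (min ((1 - p.t) + Γ.dist p.tgt q.src + q.t) ((1 - p.t) + Γ.dist p.tgt q.tgt + (1 - q.t)))

open Classical in
/-- The path length distance: along the edge, if `p` and `q` lie on the same edge, and through
endpoints of the edges otherwise. -/
noncomputable def pathDist (p q : GraphPoint Γ) : ℝ :=
  if p.src = q.src ∧ p.tgt = q.tgt then |p.t - q.t|
  else if p.src = q.tgt ∧ p.tgt = q.src then |p.t - (1 - q.t)|
  else vertexDist p q

/-- The endpoints of the edge of `p`. -/
def endpoint (p : GraphPoint Γ) (b : Bool) : V := cond b p.src p.tgt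

/-- The distances from `p` to the endpoints of its edge. -/
noncomputable def wt (p : GraphPoint Γ) (b : Bool) : ℝ := cond b p.t (1 - p.t)

theorem wt_nonneg (p : GraphPoint Γ) (b : Bool) : 0 ≤ p.wt b := by
  have := p.nonneg
  have := p.le_one
  cases b <;> simp [wt] <;> linarith

theorem vertexDist_le (p q : GraphPoint Γ) (b c : Bool) :
    vertexDist p q ≤ p.wt b + Γ.dist (p.endpoint b) (q.endpoint c) + q.wt c := by
  cases b <;> cases c <;> simp [vertexDist, wt, endpoint]

theorem exists_vertexDist (p q : GraphPoint Γ) :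
    ∃ b c, vertexDist p q = p.wt b + Γ.dist (p.endpoint b) (q.endpoint c) + q.wt c := by
  unfold vertexDist
  rcases min_choice (min (p.t + Γ.dist p.src q.src + q.t) (p.t + Γ.dist p.src q.tgt + (1 - q.t)))
    (min ((1 - p.t) + Γ.dist p.tgt q.src + q.t)
      ((1 - p.t) + Γ.dist p.tgt q.tgt + (1 - q.t))) with h | h <;> rw [h]
  · rcases min_choice (p.t + Γ.dist p.src q.src + q.t)
      (p.t + Γ.dist p.src q.tgt + (1 - q.t)) with h | h <;> rw [h]
    · exact ⟨true, true, rfl⟩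
    · exact ⟨true, false, rfl⟩
  · rcases min_choice ((1 - p.t) + Γ.dist p.tgt q.src + q.t)
      ((1 - p.t) + Γ.dist p.tgt q.tgt + (1 - q.t)) with h | h <;> rw [h]
    · exact ⟨false, true, rfl⟩
    · exact ⟨false, false, rfl⟩

theorem pathDist_cases (p q : GraphPoint Γ) :
    (∃ σ : Bool → Bool, (∀ b, p.endpoint b = q.endpoint (σ b)) ∧ (σ = id ∨ σ = not) ∧ (σ = not → p.src ≠ p.tgt) ∧
      pathDist p q = |p.wt true - q.wt (σ true)|) ∨ pathDist p q = vertexDist p q := by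
  unfold pathDist
  split_ifs with h1 h2
  · exact Or.inl ⟨id, fun b => by cases b <;> simp [endpoint, h1], Or.inl rfl,
      fun h => absurd (congrFun h true) (by simp), rfl⟩
  · exact Or.inl ⟨not, fun b => by cases b <;> simp [endpoint, h2], Or.inr rfl,
      fun _ he => h1 ⟨he.trans h2.2, he.symm.trans h2.1⟩, rfl⟩
  · exact Or.inr rfl

theorem wt_false (p : GraphPoint Γ) : p.wt false = 1 - p.wt true := rfl

/-- The local length is also the difference of the distances to any common endpoint. -/
theorem abs_wt {p q : GraphPoint Γ} {σ : Bool → Bool} (hσ : σ = id ∨ σ = not) (b : Bool) :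
    |p.wt true - q.wt (σ true)| = |p.wt b - q.wt (σ b)| := by
  rcases hσ with rfl | rfl <;> cases b <;> simp [wt_false] <;>
    rw [← abs_neg] <;> congr 1 <;> ring

theorem vertexDist_comm (p q : GraphPoint Γ) : vertexDist p q = vertexDist q p := by
  have key : ∀ p q : GraphPoint Γ, vertexDist p q ≤ vertexDist q p := fun p q => by
    obtain ⟨b, c, h⟩ := exists_vertexDist q p
    rw [h, SimpleGraph.dist_comm]
    linarith [vertexDist_le p q c b]
  exact le_antisymm (key p q) (key q p)

theorem pathDist_comm (p q : GraphPoint Γ) : pathDist p q = pathDist q p := by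
  have e1 : (q.src = p.src ∧ q.tgt = p.tgt) ↔ (p.src = q.src ∧ p.tgt = q.tgt) := by
    constructor <;> exact fun h => ⟨h.1.symm, h.2.symm⟩
  have e2 : (q.src = p.tgt ∧ q.tgt = p.src) ↔ (p.src = q.tgt ∧ p.tgt = q.src) := by
    constructor <;> exact fun h => ⟨h.2.symm, h.1.symm⟩
  have e3 : |q.t - (1 - p.t)| = |p.t - (1 - q.t)| := by
    congr 1
    ring
  unfold pathDist
  rw [e3, vertexDist_comm q p, abs_sub_comm q.t p.t]
  classical exact if_congr e1.symm rfl (if_congr e2.symm rfl rfl)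

theorem pathDist_self (p : GraphPoint Γ) : pathDist p p = 0 := by
  simp [pathDist]

theorem dist_fin_le (p : GraphPoint Γ) (b c : Bool) :
    (Γ.dist (p.endpoint b) (p.endpoint c) : ℝ) ≤ p.wt b + p.wt c := by
  by_cases hbc : b = c
  · subst hbc
    have := p.wt_nonneg b
    rw [SimpleGraph.dist_self]
    push_cast
    linarith
  · have hw : p.wt b + p.wt c = 1 := by
      cases b <;> cases c <;> simp_all [wt]
    rw [hw]
    rcases p.adj with h | ⟨h, -⟩
    · have h1 : Γ.dist p.src p.tgt = 1 := SimpleGraph.dist_eq_one_iff_adj.2 h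
      have h2 : Γ.dist p.tgt p.src = 1 := SimpleGraph.dist_eq_one_iff_adj.2 h.symm
      cases b <;> cases c <;> simp [endpoint, h1, h2]
    · cases b <;> cases c <;> simp [endpoint, h]

theorem vertexDist_triangle (hΓ : Γ.Connected) (p q r : GraphPoint Γ) :
    vertexDist p r ≤ vertexDist p q + vertexDist q r := by
  obtain ⟨b, c, h⟩ := exists_vertexDist p q
  obtain ⟨b', c', h'⟩ := exists_vertexDist q r
  have h1 := vertexDist_le p r b c'
  have h2 : Γ.dist (p.endpoint b) (r.endpoint c') ≤
      Γ.dist (p.endpoint b) (q.endpoint c) + Γ.dist (q.endpoint c) (r.endpoint c') := hΓ.dist_triangle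
  have h3 : Γ.dist (q.endpoint c) (r.endpoint c') ≤
      Γ.dist (q.endpoint c) (q.endpoint b') + Γ.dist (q.endpoint b') (r.endpoint c') := hΓ.dist_triangle
  have h4 := dist_fin_le q c b'
  have h2' : (Γ.dist (p.endpoint b) (r.endpoint c') : ℝ) ≤
      Γ.dist (p.endpoint b) (q.endpoint c) + Γ.dist (q.endpoint c) (r.endpoint c') := by exact_mod_cast h2
  have h3' : (Γ.dist (q.endpoint c) (r.endpoint c') : ℝ) ≤
      Γ.dist (q.endpoint c) (q.endpoint b') + Γ.dist (q.endpoint b') (r.endpoint c') := by exact_mod_cast h3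
  linarith

theorem pathDist_le_vertexDist (p q : GraphPoint Γ) : pathDist p q ≤ vertexDist p q := by
  rcases pathDist_cases p q with ⟨σ, hf, hσ, hn, h⟩ | h
  · obtain ⟨b, c, hv⟩ := exists_vertexDist p q
    have hb := p.wt_nonneg b
    have hc := q.wt_nonneg c
    rw [h, hv, abs_wt hσ b, hf b]
    have hq : c = σ b ∨ (c ≠ σ b) := em _
    rcases hq with rfl | hne
    · rw [SimpleGraph.dist_self]
      push_cast
      rw [abs_le]
      constructor <;> linarith
    · have hc' : q.wt c = 1 - q.wt (σ b) := by
        have : ∀ x y : Bool, x ≠ y → q.wt x = 1 - q.wt y := by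
          intro x y hxy
          cases x <;> cases y <;> simp_all [wt]
        exact this _ _ hne
      have hd : (0 : ℝ) ≤ Γ.dist (q.endpoint (σ b)) (q.endpoint c) := Nat.cast_nonneg _
      have hs := q.wt_nonneg (σ b)
      have hb1 : p.wt b ≤ 1 := by
        have := p.wt_nonneg (!b)
        cases b <;> simp_all [wt]
      rw [abs_le]
      refine ⟨?_, by linarith⟩
      rcases q.adj with ha | ⟨he, ht⟩
      · have h1 : Γ.dist (q.endpoint (σ b)) (q.endpoint c) = 1 := by
          rw [SimpleGraph.dist_eq_one_iff_adj]
          generalize σ b = x at hne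
          have ha' := ha.symm
          cases x <;> cases c <;> simp_all [endpoint]
        rw [h1]
        push_cast
        linarith
      · have hpq : p.src = p.tgt := by
          have h1 := hf true
          have h2 := hf false
          rcases hσ with rfl | rfl <;> simp_all [endpoint]
        have hp : p.t = 0 := by
          rcases p.adj with ha | ha
          · exact absurd hpq ha.ne
          · exact ha.2
        rcases hσ with rfl | rfl
        · have hb' : p.wt b = q.wt b := by cases b <;> simp [wt, hp, ht]
          simp only [id] at hd ⊢
          linarith
        · exact absurd hpq (hn rfl)
  · exact h.le

theorem vertexDist_le_add (p q r : GraphPoint Γ) :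
    vertexDist p r ≤ vertexDist p q + pathDist q r ∨ pathDist q r = vertexDist q r := by
  rcases pathDist_cases q r with ⟨σ, hf, hσ, hn, h⟩ | h
  · left
    obtain ⟨b, c, hv⟩ := exists_vertexDist p q
    have h1 := vertexDist_le p r b (σ c)
    rw [← hf c] at h1
    have h2 := neg_abs_le (q.wt c - r.wt (σ c))
    rw [h, abs_wt hσ c, hv]
    linarith
  · exact Or.inr h

theorem pathDist_le_of_fin {p r : GraphPoint Γ} {σ : Bool → Bool}
    (hf : ∀ b, p.endpoint b = r.endpoint (σ b)) (hσ : σ = id ∨ σ = not) :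
    pathDist p r ≤ |p.wt true - r.wt (σ true)| := by
  have h1 := hf true
  have h2 := hf false
  rcases hσ with rfl | rfl
  · exact (if_pos ⟨h1, h2⟩).le
  · by_cases h : p.src = r.src ∧ p.tgt = r.tgt
    · have hp : p.src = p.tgt := h.1.trans h2.symm
      have hr : r.src = r.tgt := h.1.symm.trans h1
      have hp0 : p.t = 0 := p.adj.elim (fun ha => absurd hp ha.ne) (fun ha => ha.2)
      have hr0 : r.t = 0 := r.adj.elim (fun ha => absurd hr ha.ne) (fun ha => ha.2)
      rw [pathDist, if_pos h, hp0, hr0, sub_zero, abs_zero]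
      exact abs_nonneg _
    · rw [pathDist, if_neg h]
      exact (if_pos ⟨h1, h2⟩).le

theorem pathDist_triangle (hΓ : Γ.Connected) (p q r : GraphPoint Γ) :
    pathDist p r ≤ pathDist p q + pathDist q r := by
  have hv := pathDist_le_vertexDist p r
  rcases pathDist_cases p q with ⟨σ, hf, hσ, hn, h⟩ | h
  · rcases pathDist_cases q r with ⟨τ, hf', hτ, hn', h'⟩ | h'
    · have hτσ : τ ∘ σ = id ∨ τ ∘ σ = not := by
        rcases hσ with rfl | rfl <;> rcases hτ with rfl | rfl
        · exact Or.inl rfl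
        · exact Or.inr rfl
        · exact Or.inr rfl
        · left
          funext b
          simp
      have h1 := pathDist_le_of_fin (p := p) (r := r) (σ := τ ∘ σ)
        (fun b => (hf b).trans (hf' (σ b))) hτσ
      rw [h, h', abs_wt hτ (σ true)]
      exact h1.trans (abs_sub_le _ _ _)
    · have := vertexDist_le_add r q p
      rcases this with h1 | h1
      · rw [vertexDist_comm r p, vertexDist_comm r q, pathDist_comm q p] at h1
        linarith
      · rw [pathDist_comm q p, vertexDist_comm q p] at h1
        linarith [vertexDist_triangle hΓ p q r]
  · rcases vertexDist_le_add p q r with h1 | h1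
    · linarith
    · linarith [vertexDist_triangle hΓ p q r]

/-- The path length pseudometric. -/
@[reducible] noncomputable def pseudoMetric (hΓ : Γ.Connected) :
    PseudoMetricSpace (GraphPoint Γ) where
  dist := pathDist
  dist_self := pathDist_self
  dist_comm := pathDist_comm
  dist_triangle := pathDist_triangle hΓ

end GraphPoint

namespace GGraph

variable {G : Type u} [Group G]

/-- The parametrized points of the metric graph of `Y`. -/
def Point (Y : GGraph G) : Type u := GraphPoint Y.graph

noncomputable instance (Y : GGraph G) : PseudoMetricSpace Y.Point :=
  GraphPoint.pseudoMetric Y.connected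

/-- The action on parametrized points induced by the action on vertices. -/
instance (Y : GGraph G) : SMul G Y.Point where
  smul g p := ⟨g • p.src, g • p.tgt, p.t, p.nonneg, p.le_one,
    p.adj.imp (Y.smul_adj g _ _) (fun h => ⟨congrArg (g • ·) h.1, h.2⟩)⟩

theorem point_ext {Y : GGraph G} {p q : Y.Point} (h1 : p.src = q.src) (h2 : p.tgt = q.tgt)
    (h3 : p.t = q.t) : p = q := by
  rcases p with ⟨a, b, t, _, _, _⟩
  rcases q with ⟨a', b', t', _, _, _⟩
  simp only at h1 h2 h3
  subst h1 h2 h3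
  rfl

instance (Y : GGraph G) : MulAction G Y.Point where
  one_smul p := point_ext (one_smul G p.src) (one_smul G p.tgt) rfl
  mul_smul g h p := point_ext (mul_smul g h p.src) (mul_smul g h p.tgt) rfl

theorem dist_smul_smul (Y : GGraph G) (g : G) (v w : Y.vert) :
    Y.graph.dist (g • v) (g • w) = Y.graph.dist v w := by
  have key : ∀ (g : G) (v w : Y.vert), Y.graph.dist (g • v) (g • w) ≤ Y.graph.dist v w := by
    intro g v w
    obtain ⟨p, hp⟩ := Y.connected.exists_walk_length_eq_dist v w
    rw [← hp, ← p.length_map (⟨fun v => g • v, fun h => Y.smul_adj g _ _ h⟩ : Y.graph →g Y.graph)]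
    exact SimpleGraph.dist_le _
  refine le_antisymm (key g v w) ?_
  simpa using key g⁻¹ (g • v) (g • w)

instance (Y : GGraph G) : IsIsometricSMul G Y.Point where
  isometry_smul g := by
    refine Isometry.of_dist_eq fun p q => ?_
    change GraphPoint.pathDist (Γ := Y.graph) (g • p) (g • q) = GraphPoint.pathDist p q
    have h1 : (g • p).src = g • p.src := rfl
    have h2 : (g • p).tgt = g • p.tgt := rfl
    have h3 : (g • p).t = p.t := rfl
    have h4 : (g • q).src = g • q.src := rfl
    have h5 : (g • q).tgt = g • q.tgt := rfl
    have h6 : (g • q).t = q.t := rfl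
    have hv : GraphPoint.vertexDist (Γ := Y.graph) (g • p) (g • q) =
        GraphPoint.vertexDist p q := by
      simp only [GraphPoint.vertexDist, h1, h2, h3, h4, h5, h6, Y.dist_smul_smul]
    unfold GraphPoint.pathDist
    rw [hv, h3, h6]
    classical refine if_congr ?_ rfl (if_congr ?_ rfl rfl)
    · rw [h1, h2, h4, h5, smul_left_cancel_iff, smul_left_cancel_iff]
    · rw [h1, h2, h4, h5, smul_left_cancel_iff, smul_left_cancel_iff]

/-- The geometric realization of `Y`: the metric graph with edges of length one, with the path
metric and the induced isometric action of `G`. -/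
noncomputable def realization (Y : GGraph G) : GSpace G where
  carrier := SeparationQuotient Y.Point
  isometric := ⟨fun g => by
    refine Isometry.of_dist_eq fun p q => ?_
    obtain ⟨p, rfl⟩ := SeparationQuotient.surjective_mk p
    obtain ⟨q, rfl⟩ := SeparationQuotient.surjective_mk q
    rw [← SeparationQuotient.mk_smul, ← SeparationQuotient.mk_smul, SeparationQuotient.dist_mk,
      SeparationQuotient.dist_mk, dist_smul]⟩

end GGraph

/-! ### Combinatorial horoballs -/

/-- Admissible families `B_n`, `n = 1, 2, …`, of maps from vertices to sets of vertices. -/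
structure Admissible {G : Type u} [Group G] (Y : GGraph G) (B : ℕ+ → Y.vert → Set Y.vert) :
    Prop where
  connectedness : ∀ v, B 1 v = {w | Y.graph.dist v w ≤ 1}
  exponential_growth : ∀ (n : ℕ+) (v w : Y.vert), v ∈ B n w → B n v ⊆ B (n + 1) w
  symmetry : ∀ (n : ℕ+) (v w : Y.vert), v ∈ B n w → w ∈ B n v
  equivariance : ∀ (n : ℕ+) (g : G) (w : Y.vert), (fun v => g • v) '' B n w = B n (g • w)

/-- The combinatorial horoball: the graph on `V × {1, 2, …}` with vertical edges from `(v, n)` to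
`(v, n + 1)` and horizontal edges from `(v, n)` to `(w, n)` whenever `v ∈ B_n(w)`. -/
def horoballGraph {V : Type u} (B : ℕ+ → V → Set V) : SimpleGraph (V × ℕ+) :=
  SimpleGraph.fromRel fun p q =>
    (p.1 = q.1 ∧ q.2 = p.2 + 1) ∨ (p.2 = q.2 ∧ p.1 ∈ B p.2 q.1)

/-- The combinatorial horoball based on `Y` and an admissible family, with the action of `G` on it
induced by the action on `Y`. -/
def horoball {G : Type u} [Group G] (Y : GGraph G) (B : ℕ+ → Y.vert → Set Y.vert)
    (hB : Admissible Y B) : GGraph G where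
  vert := Y.vert × ℕ+
  action :=
    { smul := fun g p => (g • p.1, p.2)
      one_smul := fun p => Prod.ext (one_smul G p.1) rfl
      mul_smul := fun g h p => Prod.ext (mul_smul g h p.1) rfl }
  graph := horoballGraph B
  connected := by
    have vertical : ∀ (v : Y.vert) (n : ℕ+), (horoballGraph B).Reachable (v, 1) (v, n) := by
      intro v n
      induction n using PNat.recOn with
      | one => exact SimpleGraph.Reachable.refl _
      | succ n ih =>
        refine ih.trans (SimpleGraph.Adj.reachable ?_)
        rw [horoballGraph, SimpleGraph.fromRel_adj]
        refine ⟨fun h => ?_, Or.inl (Or.inl ⟨rfl, rfl⟩)⟩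
        have h2 := congrArg (fun p : Y.vert × ℕ+ => (p.2 : ℕ)) h
        simp at h2
    have horizontal : ∀ v w : Y.vert, (horoballGraph B).Reachable (v, 1) (w, 1) := by
      intro v w
      obtain ⟨p⟩ := Y.connected.preconnected v w
      induction p with
      | nil => exact SimpleGraph.Reachable.refl _
      | cons h _ ih =>
        refine (SimpleGraph.Adj.reachable ?_).trans ih
        rw [horoballGraph, SimpleGraph.fromRel_adj]
        refine ⟨fun he => h.ne (congrArg Prod.fst he), Or.inl (Or.inr ⟨rfl, ?_⟩)⟩
        rw [hB.connectedness]
        exact (SimpleGraph.dist_eq_one_iff_adj.2 h.symm).le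
    have := Y.connected.nonempty
    exact ⟨fun p q => ((vertical p.1 p.2).symm.trans (horizontal p.1 q.1)).trans
      (vertical q.1 q.2)⟩
  smul_adj := by
    intro g v w h
    rw [horoballGraph, SimpleGraph.fromRel_adj] at h ⊢
    have hmem : ∀ (n : ℕ+) (a b : Y.vert), a ∈ B n b → g • a ∈ B n (g • b) := fun n a b hab => by
      rw [← hB.equivariance]
      exact ⟨a, hab, rfl⟩
    have key : ∀ p q : Y.vert × ℕ+,
        (p.1 = q.1 ∧ q.2 = p.2 + 1) ∨ (p.2 = q.2 ∧ p.1 ∈ B p.2 q.1) →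
        (g • p.1 = g • q.1 ∧ q.2 = p.2 + 1) ∨ (p.2 = q.2 ∧ g • p.1 ∈ B p.2 (g • q.1)) :=
      fun p q hpq => hpq.imp (fun h => ⟨congrArg (g • ·) h.1, h.2⟩)
        (fun h => ⟨h.1, hmem _ _ _ h.2⟩)
    exact ⟨fun he => h.1 (Prod.ext (smul_left_cancel g (congrArg Prod.fst he))
      (congrArg Prod.snd he :)), h.2.imp (key v w) (key w v)⟩

/-- `X` has an invariant horoball: it is equivalent to a hyperbolic `G`-space which is the
combinatorial horoball based on some connected graph with a `G`-action and some admissible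
family. -/
def HasInvariantHoroball {G : Type u} [Group G] (X : HypGSpace G) : Prop :=
  ∃ (Y : GGraph G) (B : ℕ+ → Y.vert → Set Y.vert) (hB : Admissible Y B)
    (hH : (horoball Y B hB).realization.IsHyperbolic),
    Equivalent X ⟨(horoball Y B hB).realization, hH⟩

end HoroEq

/-! Fix a base point `x` of `X` and write |g| = d(x, gx). The real content is that condition (2)
reduces to the absence of hyperbolic elements, and that this absence makes G coarsely ultrametric.
If |g²| exceeds |g| by more than 2δ, the four point inequality makes |gⁿ| grow linearly
(`FourPoint.displacement_pow_succ`), so g is hyperbolic. If no g is hyperbolic, then |g²| ≤ |g| + c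
for all g, and a few more applications of the four point inequality give |gk| ≤ max(|g|, |k|) + C
(`FourPoint.displacement_mul_le_max`). Hence either the orbit of `x` is bounded, or all far points
of the orbit converge to one boundary point, which G must fix; in both cases X is elementary.

(1) ⇒ (3): every point of a horoball can be joined to a high point over a fixed vertex by an almost
vertical path, so all sequences tending to infinity are equivalent. (3) ⇒ (2): existence of
hyperbolic elements is invariant under equivalence, and a hyperbolic element has two distinct limit
points.

(2) ⇒ (1): by the coarse ultrametric inequality, 2^(|g⁻¹h| / 2C) is within a factor two of a left
invariant pseudometric ρ on G (chain metrization). Form the horoball over (G, ρ), using balls of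
radius 2^(n-1). Its distance from (g, n) to (h, m) is 2 log₂ max(ρ(g, h), 2ⁿ, 2ᵐ) - n - m up to a
bounded error; hyperbolicity then amounts to a Ptolemy inequality for that maximum. Multiplied by C,
the formula becomes max(|g⁻¹h|, 2Cn, 2Cm) - Cn - Cm. When orbits are unbounded this is also the
distance in X between g c(n) and h c(m), where c is a coarse ray from `x` to the fixed point, so (g,
n) ↦ g c(n) embeds the cusp in X. When orbits are bounded, both spaces are equivalent to a point.

The unit balls of ρ need not come from a connected graph on G, so the cusp need not be an admissible
horoball. The Kuratowski embedding of (G, ρ) into functions with the supremum distance repairs this: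
there the unit balls do define a connected graph, and horoball distances depend, up to a bounded
error, only on ρ and the heights. -/

namespace HoroEq

/-! ### The four point inequality -/

/-- Gromov's four point inequality. -/
def FourPoint (X : Type*) [MetricSpace X] (δ : ℝ) : Prop :=
  ∀ x y z w : X,
    dist x z + dist y w ≤ max (dist x y + dist z w) (dist x w + dist y z) + 2 * δ

section FourPoint

variable {X : Type*} [MetricSpace X] {δ : ℝ}

theorem gromovProduct_comm (x y p : X) : gromovProduct x y p = gromovProduct y x p := by
  rw [gromovProduct, gromovProduct, dist_comm x y]
  ring

theorem gromovProduct_nonneg (x y p : X) : 0 ≤ gromovProduct x y p := by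
  rw [gromovProduct]
  have := dist_triangle_right x y p
  linarith

theorem gromovProduct_le_left (x y p : X) : gromovProduct x y p ≤ dist x p := by
  rw [gromovProduct]
  have := dist_triangle y x p
  rw [dist_comm y x] at this
  linarith

theorem gromovProduct_le_right (x y p : X) : gromovProduct x y p ≤ dist y p := by
  rw [gromovProduct_comm]
  exact gromovProduct_le_left y x p

theorem gromovProduct_basepoint (x y p q : X) :
    gromovProduct x y p - dist p q ≤ gromovProduct x y q := by
  rw [gromovProduct, gromovProduct]
  have h1 := dist_triangle_right x p q
  have h2 := dist_triangle_right y p q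
  linarith

theorem FourPoint.min_le (h : FourPoint X δ) (x y z p : X) :
    min (gromovProduct x y p) (gromovProduct y z p) ≤ gromovProduct x z p + δ := by
  have := h x y z p
  simp only [gromovProduct]
  rcases le_total (dist x y + dist z p) (dist x p + dist y z) with h1 | h1
  · rw [max_eq_right h1] at this
    exact (min_le_right _ _).trans (by linarith)
  · rw [max_eq_left h1] at this
    exact (min_le_left _ _).trans (by linarith)

/-- Let t be the smaller of the two Gromov products at p. The points at distance t from p on the
geodesics to x, y, z are consecutively δ-close, so d(x, z) ≤ (d(x, p) - t) + 2δ + (d(z, p) - t). -/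
theorem HasThinTriangles.fourPoint (h : HasThinTriangles X δ) (hX : IsGeodesicSpace X) :
    FourPoint X δ := by
  intro x y z p
  obtain ⟨c, hc⟩ := hX p x
  obtain ⟨c', hc'⟩ := hX p y
  obtain ⟨c'', hc''⟩ := hX p z
  set t := min (gromovProduct x y p) (gromovProduct y z p) with ht
  have ht0 : 0 ≤ t := le_min (gromovProduct_nonneg _ _ _) (gromovProduct_nonneg _ _ _)
  have h1 := h.2 p x y c c' hc hc' t ⟨ht0, min_le_left _ _⟩
  have h2 := h.2 p y z c' c'' hc' hc'' t ⟨ht0, min_le_right _ _⟩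
  have hx : t ≤ dist p x := (min_le_left _ _).trans
    ((gromovProduct_le_left _ _ _).trans (dist_comm _ _).le)
  have hz : t ≤ dist p z := (min_le_right _ _).trans
    ((gromovProduct_le_right _ _ _).trans (dist_comm _ _).le)
  have e1 : dist (c t) x = dist p x - t := by
    have := hc.2.2 t ⟨ht0, hx⟩ (dist p x) ⟨dist_nonneg, le_rfl⟩
    rw [hc.2.1, abs_sub_comm, abs_of_nonneg (by linarith)] at this
    exact this
  have e2 : dist (c'' t) z = dist p z - t := by
    have := hc''.2.2 t ⟨ht0, hz⟩ (dist p z) ⟨dist_nonneg, le_rfl⟩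
    rw [hc''.2.1, abs_sub_comm, abs_of_nonneg (by linarith)] at this
    exact this
  have h3 : dist x z ≤ dist (c t) x + (dist (c t) (c' t) + dist (c' t) (c'' t)) + dist (c'' t) z := by
    have a1 := dist_triangle_left x z (c t)
    have a2 := dist_triangle (c t) (c'' t) z
    have a3 := dist_triangle (c t) (c' t) (c'' t)
    linarith
  rw [dist_comm p x] at e1
  rw [dist_comm p z] at e2
  have h4 : dist x z + 2 * t ≤ dist x p + dist z p + 2 * δ := by linarith
  rcases min_choice (gromovProduct x y p) (gromovProduct y z p) with h5 | h5
  · rw [ht, h5, gromovProduct] at h4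
    have := le_max_left (dist x y + dist z p) (dist x p + dist y z)
    linarith
  · rw [ht, h5, gromovProduct] at h4
    have := le_max_right (dist x y + dist z p) (dist x p + dist y z)
    linarith

theorem IsGeodesicFromTo.dist_left {c : ℝ → X} {x y : X} (h : IsGeodesicFromTo c x y) {s : ℝ}
    (hs : s ∈ Set.Icc 0 (dist x y)) : dist (c s) x = s := by
  have := h.2.2 s hs 0 ⟨le_rfl, dist_nonneg⟩
  rwa [h.1, sub_zero, abs_of_nonneg hs.1] at this

theorem IsGeodesicFromTo.dist_right {c : ℝ → X} {x y : X} (h : IsGeodesicFromTo c x y) {s : ℝ}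
    (hs : s ∈ Set.Icc 0 (dist x y)) : dist (c s) y = dist x y - s := by
  have := h.2.2 s hs (dist x y) ⟨dist_nonneg, le_rfl⟩
  rwa [h.2.1, abs_sub_comm, abs_of_nonneg (sub_nonneg.2 hs.2)] at this

/-- Consecutive Gromov products along `c s`, y, z, `c' s` based at x are all at least s, so two uses
of `FourPoint.min_le` put `c s` and `c' s` within 4δ. The summand 1 makes the bound strict and the
constant positive. -/
theorem FourPoint.hasThinTriangles (h : FourPoint X δ) (hδ : 0 ≤ δ) :
    HasThinTriangles X (4 * δ + 1) := by
  refine ⟨by linarith, fun x y z c c' hc hc' s hs => ?_⟩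
  have hy : s ∈ Set.Icc 0 (dist x y) :=
    ⟨hs.1, hs.2.trans ((gromovProduct_le_left _ _ _).trans (dist_comm _ _).le)⟩
  have hz : s ∈ Set.Icc 0 (dist x z) :=
    ⟨hs.1, hs.2.trans ((gromovProduct_le_right _ _ _).trans (dist_comm _ _).le)⟩
  have h1 := hc.dist_left hy
  have h2 := hc.dist_right hy
  have h3 := hc'.dist_left hz
  have h4 := hc'.dist_right hz
  have e1 : gromovProduct (c s) y x = s := by
    rw [gromovProduct, h1, h2, dist_comm y x]
    ring
  have e2 : gromovProduct z (c' s) x = s := by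
    rw [gromovProduct_comm, gromovProduct, h3, h4, dist_comm z x]
    ring
  have h5 := h.min_le (c s) y z x
  have h6 := h.min_le (c s) z (c' s) x
  rw [e1, min_eq_left hs.2] at h5
  rw [e2] at h6
  have h7 : s - δ ≤ min (gromovProduct (c s) z x) s := le_min (by linarith) (by linarith)
  have h8 : gromovProduct (c s) (c' s) x = (s + s - dist (c s) (c' s)) / 2 := by
    rw [gromovProduct, h1, h3]
  linarith

end FourPoint

theorem HypGSpace.exists_fourPoint {G : Type u} [Group G] (X : HypGSpace G) :
    ∃ δ, 0 < δ ∧ FourPoint X.carrier δ := by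
  obtain ⟨-, hg, δ, hδ⟩ := X.isHyperbolic
  exact ⟨δ, hδ.1, hδ.fourPoint hg⟩

/-! ### Sequences tending to infinity -/

section Sequences

variable {X : Type*} [MetricSpace X] {δ : ℝ}

theorem tendsto_gromovProduct_of_basepoint {x y : ℕ → X} (p : X)
    (h : Tendsto (fun ij : ℕ × ℕ => gromovProduct (x ij.1) (y ij.2) p) atTop atTop) :
    SeqEquiv x y := by
  intro q
  refine tendsto_atTop_mono (fun ij => gromovProduct_basepoint _ _ p q) ?_
  exact tendsto_atTop_add_const_right _ _ h

theorem tendsto_prod_atTop_iff {f : ℕ × ℕ → ℝ} :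
    Tendsto f atTop atTop ↔ ∀ R, ∃ N, ∀ i ≥ N, ∀ j ≥ N, R ≤ f (i, j) := by
  rw [tendsto_atTop_atTop]
  refine forall_congr' fun R => ⟨fun ⟨⟨a, b⟩, h⟩ => ?_, fun ⟨N, h⟩ => ?_⟩
  · exact ⟨max a b, fun i hi j hj =>
      h (i, j) ⟨(le_max_left _ _).trans hi, (le_max_right _ _).trans hj⟩⟩
  · exact ⟨(N, N), fun ij hij => h _ hij.1 _ hij.2⟩

theorem seqEquiv_of_le {x y : ℕ → X} (p : X)
    (h : ∀ R, ∃ N, ∀ i ≥ N, ∀ j ≥ N, R ≤ gromovProduct (x i) (y j) p) : SeqEquiv x y :=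
  tendsto_gromovProduct_of_basepoint p (tendsto_prod_atTop_iff.2 h)

theorem tendsToInfinity_of_le {x : ℕ → X} (p : X)
    (h : ∀ R, ∃ N, ∀ i ≥ N, ∀ j ≥ N, R ≤ gromovProduct (x i) (x j) p) : TendsToInfinity x :=
  seqEquiv_of_le p h

theorem SeqEquiv.symm {x y : ℕ → X} (h : SeqEquiv x y) : SeqEquiv y x := by
  intro p
  have := tendsto_prod_atTop_iff.1 (h p)
  refine tendsto_prod_atTop_iff.2 fun R => ?_
  obtain ⟨N, hN⟩ := this R
  exact ⟨N, fun i hi j hj => by simpa only [gromovProduct_comm] using hN j hj i hi⟩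

theorem FourPoint.seqEquiv_trans (hX : FourPoint X δ) {x y z : ℕ → X} (h : SeqEquiv x y)
    (h' : SeqEquiv y z) : SeqEquiv x z := by
  intro p
  refine tendsto_prod_atTop_iff.2 fun R => ?_
  obtain ⟨N, hN⟩ := tendsto_prod_atTop_iff.1 (h p) (R + δ)
  obtain ⟨N', hN'⟩ := tendsto_prod_atTop_iff.1 (h' p) (R + δ)
  refine ⟨max N N', fun i hi k hk => ?_⟩
  have h1 := hN i ((le_max_left _ _).trans hi) (max N N') (le_max_left _ _)
  have h2 := hN' (max N N') (le_max_right _ _) k ((le_max_right _ _).trans hk)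
  have h3 := hX.min_le (x i) (y (max N N')) (z k) p
  have h4 := le_min h1 h2
  simp only at h4 ⊢
  linarith

/-- Equality in `Quot` only gives the generated equivalence relation; hyperbolicity makes `SeqEquiv`
transitive, so nothing is added. -/
theorem FourPoint.seqEquiv_of_mk_eq (hX : FourPoint X δ)
    {x y : {x : ℕ → X // TendsToInfinity x}}
    (h : (Quot.mk _ x : Boundary X) = Quot.mk _ y) : SeqEquiv x.1 y.1 := by
  have := Quot.eqvGen_exact h
  clear h
  induction this with
  | rel _ _ h => exact h
  | refl x => exact x.2
  | symm _ _ _ ih => exact ih.symm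
  | trans _ _ _ _ _ ih1 ih2 => exact hX.seqEquiv_trans ih1 ih2

theorem subsingleton_boundary (h : ∀ x y : ℕ → X, TendsToInfinity x → TendsToInfinity y →
    SeqEquiv x y) : Subsingleton (Boundary X) :=
  ⟨fun a b => Quot.induction_on₂ a b fun x y => Quot.sound (h x.1 y.1 x.2 y.2)⟩

theorem TendsToInfinity.exists_le_dist {x : ℕ → X} (h : TendsToInfinity x) (p : X) (R : ℝ) :
    ∃ N, ∀ i ≥ N, R ≤ dist (x i) p := by
  obtain ⟨N, hN⟩ := tendsto_prod_atTop_iff.1 (h p) R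
  exact ⟨N, fun i hi => (hN i hi i hi).trans (gromovProduct_le_left _ _ _)⟩

end Sequences

/-! ### Displacements -/

section Displacement

variable {G X : Type*} [Group G] [MetricSpace X] [MulAction G X] {δ : ℝ}

/-- The displacement of `x` under `g`. -/
noncomputable def displacement (x : X) (g : G) : ℝ := dist x (g • x)

theorem displacement_nonneg (x : X) (g : G) : 0 ≤ displacement x g := dist_nonneg

theorem displacement_one (x : X) : displacement x (1 : G) = 0 := by
  simp [displacement]

theorem le_displacement_pow_add {x : X} {g : G} {e : ℝ}
    (h : ∀ n : ℕ, displacement x (g ^ n) + e ≤ displacement x (g ^ (n + 1))) (m n : ℕ) :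
    displacement x (g ^ m) + n * e ≤ displacement x (g ^ (m + n)) := by
  induction n with
  | zero => simp
  | succ n ih =>
    have := h (m + n)
    push_cast
    rw [← add_assoc]
    linarith

/-- Linear growth of the displacements of the powers of `g`. -/
def LinearGrowth (x : X) (g : G) : Prop :=
  ∃ K > (0 : ℝ), ∃ C, ∀ n : ℕ, K * n - C ≤ displacement x (g ^ n)

/-- Otherwise repeated squaring gives |g^(2^i)| ≤ |g| + ic, which is logarithmic in the exponent and
contradicts linear growth because i / 2^i → 0. -/
theorem LinearGrowth.exists_pow {x : X} {g : G} (h : LinearGrowth x g) (c : ℝ) :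
    ∃ n : ℕ, displacement x (g ^ n) + c ≤ displacement x ((g ^ n) ^ 2) := by
  by_contra hcon
  push Not at hcon
  obtain ⟨K, hK, C, h⟩ := h
  have h1 : ∀ i : ℕ, displacement x (g ^ (2 ^ i)) ≤ displacement x g + i * c := by
    intro i
    induction i with
    | zero => simp
    | succ i ih =>
      have := hcon (2 ^ i)
      rw [← pow_mul, ← pow_succ] at this
      push_cast
      linarith
  have hlim : Tendsto (fun i : ℕ => (i : ℝ) / 2 ^ i) atTop (nhds 0) := by
    have := tendsto_pow_const_div_const_pow_of_one_lt 1 (r := (2 : ℝ)) (by norm_num)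
    simpa using this
  have hlim' : Tendsto (fun i : ℕ => (1 : ℝ) / 2 ^ i) atTop (nhds 0) := by
    have := tendsto_pow_const_div_const_pow_of_one_lt 0 (r := (2 : ℝ)) (by norm_num)
    simpa using this
  have hlim2 := (hlim.mul_const c).add (hlim'.mul_const (displacement x g + C))
  rw [zero_mul, zero_mul, add_zero] at hlim2
  obtain ⟨i, hi⟩ := (hlim2.eventually (gt_mem_nhds hK)).exists
  have h2 := (h (2 ^ i)).trans (h1 i)
  have hp : (0 : ℝ) < 2 ^ i := by positivity
  have h3 : (i : ℝ) / 2 ^ i * c + 1 / 2 ^ i * (displacement x g + C) =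
      (i * c + (displacement x g + C)) / 2 ^ i := by ring
  rw [h3, div_lt_iff₀ hp] at hi
  push_cast at h2
  linarith

variable [IsIsometricSMul G X]

theorem dist_smul_smul_eq (x : X) (g h : G) :
    dist (g • x) (h • x) = displacement x (g⁻¹ * h) := by
  rw [displacement, ← dist_smul g x, mul_smul, smul_inv_smul]

theorem displacement_inv (x : X) (g : G) : displacement x g⁻¹ = displacement x g := by
  have := dist_smul_smul_eq x g 1
  rw [mul_one, one_smul, dist_comm] at this
  exact this.symm

theorem displacement_mul_le (x : X) (g h : G) :
    displacement x (g * h) ≤ displacement x g + displacement x h := by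
  have h1 := dist_triangle x (g • x) ((g * h) • x)
  rwa [dist_smul_smul_eq, inv_mul_cancel_left] at h1

theorem displacement_pow_le (x : X) (g : G) (n : ℕ) :
    displacement x (g ^ n) ≤ n * displacement x g := by
  induction n with
  | zero => simp [displacement_one]
  | succ n ih =>
    rw [pow_succ]
    have := displacement_mul_le x (g ^ n) g
    push_cast
    linarith

theorem displacement_le_of_dist (x y : X) (g : G) :
    displacement y g ≤ displacement x g + 2 * dist x y := by
  have h1 := dist_triangle4 y x (g • x) (g • y)
  rw [dist_smul, dist_comm y x] at h1
  simp only [displacement]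
  linarith

theorem gromovProduct_orbit (x : X) (g h : G) :
    gromovProduct (g • x) (h • x) x =
      (displacement x g + displacement x h - displacement x (g⁻¹ * h)) / 2 := by
  rw [gromovProduct, dist_smul_smul_eq, dist_comm (g • x), dist_comm (h • x)]
  rfl

/-- If `g²` moves `x` much further than `g`, then the displacements of `gⁿ` grow linearly. -/
theorem FourPoint.displacement_pow_succ (hX : FourPoint X δ) {x : X} {g : G} {e : ℝ} (he : 0 < e)
    (h : displacement x g + e + 2 * δ ≤ displacement x (g ^ 2)) (hδ : 0 ≤ δ) (n : ℕ) :
    displacement x (g ^ n) + e ≤ displacement x (g ^ (n + 1)) := by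
  induction n with
  | zero =>
    have := displacement_pow_le x g 2
    simp only [pow_zero, displacement_one, zero_add, pow_one]
    push_cast at this
    linarith
  | succ n ih =>
    have h1 := hX x (g ^ n • x) (g ^ (n + 1) • x) (g ^ (n + 2) • x)
    simp only [dist_smul_smul_eq] at h1
    have e1 : (g ^ n)⁻¹ * g ^ (n + 2) = g ^ 2 := by rw [pow_add]; group
    have e2 : (g ^ (n + 1))⁻¹ * g ^ (n + 2) = g := by rw [pow_add, pow_add]; group
    have e3 : (g ^ n)⁻¹ * g ^ (n + 1) = g := by rw [pow_add]; group
    rw [e1, e2, e3] at h1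
    change displacement x (g ^ (n + 1)) + displacement x (g ^ 2) ≤
      max (displacement x (g ^ n) + displacement x g)
        (displacement x (g ^ (n + 2)) + displacement x g) + 2 * δ at h1
    -- The first alternative contradicts the induction hypothesis together with `h`; the second is
    -- the claim after cancelling |g|.
    rcases max_choice (displacement x (g ^ n) + displacement x g)
        (displacement x (g ^ (n + 2)) + displacement x g) with h2 | h2 <;> rw [h2] at h1
    · linarith
    · change _ ≤ displacement x (g ^ (n + 2))
      linarith

theorem displacement_zpow (x : X) (g : G) (n : ℤ) :
    displacement x (g ^ n) = displacement x (g ^ n.natAbs) := by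
  obtain ⟨k, rfl | rfl⟩ := n.eq_nat_or_neg
  · simp
  · simp [displacement_inv]

theorem dist_zpow_smul (x : X) (g : G) (m n : ℤ) :
    dist (g ^ m • x) (g ^ n • x) = displacement x (g ^ (m - n).natAbs) := by
  rw [dist_smul_smul_eq, ← zpow_neg, ← zpow_add, displacement_zpow]
  congr 2
  omega

theorem dist_int_eq_natAbs (m n : ℤ) : dist m n = ((m - n).natAbs : ℝ) := by
  rw [Int.dist_eq, Nat.cast_natAbs, Int.cast_abs]
  push_cast
  rfl

theorem linearGrowth_iff (x : X) (g : G) :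
    LinearGrowth x g ↔ ∃ K C, IsQIEmbedding K C (fun n : ℤ => g ^ n • x) := by
  constructor
  · rintro ⟨K, hK, C, h⟩
    refine ⟨max 1 (max K⁻¹ (displacement x g)), max 0 C, le_max_left _ _, le_max_left _ _,
      fun m n => ?_⟩
    rw [dist_zpow_smul, dist_int_eq_natAbs]
    set k := (m - n).natAbs
    have h1 := h k
    have h2 := displacement_pow_le x g k
    have h3 : displacement x g ≤ max 1 (max K⁻¹ (displacement x g)) :=
      (le_max_right _ _).trans (le_max_right _ _)
    have h4 : (max 1 (max K⁻¹ (displacement x g)))⁻¹ ≤ K :=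
      inv_le_of_inv_le₀ hK ((le_max_left _ _).trans (le_max_right _ _))
    have hk : (0 : ℝ) ≤ k := Nat.cast_nonneg _
    have h5 := mul_le_mul_of_nonneg_right h3 hk
    have h6 := mul_le_mul_of_nonneg_right h4 hk
    have h7 := le_max_left 0 C
    have h8 := le_max_right 0 C
    constructor <;> linarith
  · rintro ⟨K, C, hK, -, h⟩
    refine ⟨K⁻¹, by positivity, C, fun n => ?_⟩
    have := (h n 0).1
    rw [dist_zpow_smul, dist_int_eq_natAbs] at this
    simpa using this

theorem LinearGrowth.of_dist {x : X} {g : G} (h : LinearGrowth x g) (y : X) :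
    LinearGrowth y g := by
  obtain ⟨K, hK, C, h⟩ := h
  refine ⟨K, hK, C + 2 * dist y x, fun n => ?_⟩
  have := displacement_le_of_dist y x (g ^ n)
  have := h n
  linarith

theorem FourPoint.linearGrowth (hX : FourPoint X δ) (hδ : 0 ≤ δ) {x : X} {g : G} {e : ℝ}
    (he : 0 < e) (h : displacement x g + e + 2 * δ ≤ displacement x (g ^ 2)) :
    LinearGrowth x g := by
  refine ⟨e, he, 0, fun n => ?_⟩
  have := le_displacement_pow_add (hX.displacement_pow_succ he h hδ) 0 n
  rw [pow_zero, displacement_one, zero_add, zero_add] at this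
  linarith

/-- If all displacements of squares are controlled, then the orbit is coarsely ultrametric. -/
theorem FourPoint.displacement_mul_le_max (hX : FourPoint X δ) (hδ : 0 ≤ δ) {x : X} {c : ℝ}
    (hc : 0 ≤ c)
    (h : ∀ g : G, displacement x (g ^ 2) ≤ displacement x g + c) (g k : G) :
    displacement x (g * k) ≤ max (displacement x g) (displacement x k) + (3 * c + 6 * δ) := by
  -- The four points x, gx, gkx, (gk)²x. Since |(gk)²| ≤ |gk| + c, the term |gk| cancels from both
  -- alternatives.
  have conj : ∀ g k : G, displacement x (k * g * k) ≤
      max (displacement x g) (displacement x k) + (c + 2 * δ) := by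
    intro g k
    have h1 := hX x (g • x) ((g * k) • x) ((g * k * g * k) • x)
    simp only [dist_smul_smul_eq] at h1
    have e1 : g⁻¹ * (g * k * g * k) = k * g * k := by group
    have e2 : g⁻¹ * (g * k) = k := by group
    have e3 : (g * k)⁻¹ * (g * k * g * k) = g * k := by group
    have e4 : g * k * g * k = (g * k) ^ 2 := by rw [pow_two]; group
    rw [e1, e2, e3, e4] at h1
    change displacement x (g * k) + displacement x (k * g * k) ≤
      max (displacement x g + displacement x (g * k))
        (displacement x ((g * k) ^ 2) + displacement x k) + 2 * δ at h1
    have h2 := h (g * k)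
    have h3 := le_max_left (displacement x g) (displacement x k)
    have h4 := le_max_right (displacement x g) (displacement x k)
    rcases max_choice (displacement x g + displacement x (g * k))
        (displacement x ((g * k) ^ 2) + displacement x k) with h5 | h5 <;> rw [h5] at h1 <;>
      linarith
  set m := max (displacement x g) (displacement x k) with hm
  have hg : displacement x g ≤ m := le_max_left _ _
  have hk : displacement x k ≤ m := le_max_right _ _
  -- Taking b⁻¹a as the middle factor in `conj` trades ab for a⁻¹b. Applied twice, this bounds |gk|
  -- by max(|kg|, m) up to a constant.
  have swap : ∀ a b : G, displacement x b ≤ m →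
      displacement x (a * b) ≤ max (displacement x (a⁻¹ * b)) m + (c + 2 * δ) := by
    intro a b hb
    have h1 := conj (b⁻¹ * a) b
    have e1 : b * (b⁻¹ * a) * b = a * b := by group
    have e2 : b⁻¹ * a = (a⁻¹ * b)⁻¹ := by group
    rw [e1, e2, displacement_inv] at h1
    exact h1.trans (by gcongr)
  have s1 := swap g k hk
  have s2 := swap k⁻¹ g hg
  rw [inv_inv, ← displacement_inv x (k⁻¹ * g), show (k⁻¹ * g)⁻¹ = g⁻¹ * k by group] at s2
  -- A bound on the sum |gk| + |kg| by 2m. As |gk| is coarsely at most max(|kg|, m), it follows that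
  -- |gk| itself is coarsely at most m.
  have h1 := hX x (g • x) ((g * k) • x) ((g * k * g) • x)
  simp only [dist_smul_smul_eq] at h1
  have e1 : g⁻¹ * (g * k * g) = k * g := by group
  have e2 : g⁻¹ * (g * k) = k := by group
  have e3 : (g * k)⁻¹ * (g * k * g) = g := by group
  rw [e1, e2, e3] at h1
  change displacement x (g * k) + displacement x (k * g) ≤
    max (displacement x g + displacement x g)
      (displacement x (g * k * g) + displacement x k) + 2 * δ at h1
  have h2 := conj k g
  rw [max_comm, ← hm] at h2
  have h3 : displacement x (g * k) + displacement x (k * g) ≤ 2 * m + c + 4 * δ := by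
    rcases max_choice (displacement x g + displacement x g)
        (displacement x (g * k * g) + displacement x k) with h5 | h5 <;> rw [h5] at h1 <;>
      linarith
  rcases max_choice (displacement x (g⁻¹ * k)) m with h5 | h5 <;> rw [h5] at s1 <;>
    rcases max_choice (displacement x (k * g)) m with h6 | h6 <;> rw [h6] at s2 <;>
    linarith

theorem exists_displacement_mul_le_max (hX : FourPoint X δ) (hδ : 0 < δ) (x : X)
    (h : ∀ g : G, ¬ LinearGrowth x g) :
    ∃ C > 0, ∀ g k : G,
      displacement x (g * k) ≤ max (displacement x g) (displacement x k) + C := by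
  -- The constant is e + 2δ with e = δ: a larger gap between |g²| and |g| would force linear growth.
  refine ⟨_, ?_, hX.displacement_mul_le_max (c := δ + 2 * δ) hδ.le (by positivity) fun g => ?_⟩
  · positivity
  · by_contra hg
    push Not at hg
    exact h g (hX.linearGrowth hδ.le hδ (by linarith))

/-- |g⁻¹k| ≤ max(|g|, |k|) + C leaves (min(|g|, |k|) - C) / 2 for the Gromov product, so far orbit
points all lie in one direction. -/
theorem le_gromovProduct_orbit {x : X} {C : ℝ}
    (hC : ∀ g k : G, displacement x (g * k) ≤ max (displacement x g) (displacement x k) + C)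
    {R : ℝ} {g k : G} (hg : 2 * R + C ≤ displacement x g) (hk : 2 * R + C ≤ displacement x k) :
    R ≤ gromovProduct (g • x) (k • x) x := by
  rw [gromovProduct_orbit]
  have := hC g⁻¹ k
  rw [displacement_inv] at this
  rcases max_choice (displacement x g) (displacement x k) with h | h <;> rw [h] at this <;>
    linarith

/-- A group with unbounded orbits and coarsely ultrametric displacements fixes a boundary
point. -/
theorem exists_fixed_boundary_point {x : X} {C : ℝ}
    (hC : ∀ g k : G, displacement x (g * k) ≤ max (displacement x g) (displacement x k) + C)
    (hx : ∀ R : ℝ, ∃ g : G, R < displacement x g) :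
    ∃ ξ : Boundary X, ∀ g : G, Boundary.smul g ξ = ξ := by
  choose g hg using fun n : ℕ => hx n
  have key : ∀ k : G, SeqEquiv (fun i => k • g i • x) (fun i => g i • x) := by
    intro k
    refine seqEquiv_of_le x fun R => ?_
    obtain ⟨N, hN⟩ := exists_nat_ge (2 * R + C + displacement x k)
    refine ⟨N, fun i hi j hj => ?_⟩
    have hi' : (N : ℝ) ≤ i := Nat.cast_le.2 hi
    have hj' : (N : ℝ) ≤ j := Nat.cast_le.2 hj
    have h1 := hg i
    have h2 := hg j
    have h3 := displacement_nonneg x k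
    have h4 := displacement_mul_le x k⁻¹ (k * g i)
    rw [inv_mul_cancel_left, displacement_inv] at h4
    change R ≤ gromovProduct (k • g i • x) (g j • x) x
    rw [← mul_smul]
    exact le_gromovProduct_orbit hC (by linarith) (by linarith)
  refine ⟨Quot.mk _ ⟨fun i => g i • x, ?_⟩, fun k => Quot.sound (key k)⟩
  -- Equivalence of a sequence with itself is the condition of tending to infinity.
  have := key 1
  simp only [one_smul] at this
  exact this

/-- A linearly growing isometry yields two different boundary points. -/
theorem FourPoint.not_subsingleton_boundary (hX : FourPoint X δ) (hδ : 0 < δ) {x : X} {g : G}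
    (h : LinearGrowth x g) : ¬ Subsingleton (Boundary X) := by
  -- One 2δ is the margin needed by `displacement_pow_succ`; the other is the growth e of the powers
  -- of k, and it also produces the final contradiction.
  obtain ⟨n, hn⟩ := h.exists_pow (2 * δ + 2 * δ)
  rw [← add_assoc] at hn
  set k := g ^ n
  set e := 2 * δ
  have he : 0 < e := by positivity
  have hgr := hX.displacement_pow_succ he hn hδ.le
  have hpos : ∀ k' : G, (∀ n : ℕ, displacement x (k' ^ n) = displacement x (k ^ n)) →
      TendsToInfinity fun i : ℕ => k' ^ i • x := by
    intro k' hk'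
    refine tendsToInfinity_of_le (x := fun i : ℕ => k' ^ i • x) x fun R => ?_
    obtain ⟨N, hN⟩ := exists_nat_ge (R / e)
    rw [div_le_iff₀ he] at hN
    have main : ∀ i ≥ N, ∀ j ≥ i, R ≤ gromovProduct (k' ^ i • x) (k' ^ j • x) x := by
      intro i hi j hj
      obtain ⟨l, rfl⟩ := Nat.exists_eq_add_of_le hj
      rw [gromovProduct_orbit, pow_add, inv_mul_cancel_left, ← pow_add, hk', hk', hk']
      have h1 := le_displacement_pow_add hgr 0 i
      have h2 := le_displacement_pow_add hgr l i
      rw [add_comm l] at h2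
      rw [pow_zero, displacement_one, zero_add, zero_add] at h1
      have : (N : ℝ) * e ≤ i * e := by gcongr
      linarith
    refine ⟨N, fun i hi j hj => ?_⟩
    rcases le_total i j with hij | hij
    · exact main i hi j hij
    · rw [gromovProduct_comm]
      exact main j hj i hij
  have ht := hpos k fun _ => rfl
  have ht' := hpos k⁻¹ fun n => by rw [inv_pow, displacement_inv]
  intro hs
  have heq := hX.seqEquiv_of_mk_eq (hs.elim (Quot.mk _ ⟨_, ht⟩) (Quot.mk _ ⟨_, ht'⟩))
  obtain ⟨N, hN⟩ := tendsto_prod_atTop_iff.1 (heq x) ((displacement x k + e) / 2)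
  have h1 := hN (N + 1) (by omega) (N + 1) (by omega)
  simp only at h1
  have hsucc : ∀ k' : G, (∀ n : ℕ, displacement x (k' ^ n) = displacement x (k ^ n)) →
      (displacement x k + e) / 2 ≤ gromovProduct (k' • x) (k' ^ (N + 1) • x) x := by
    intro k' hk'
    have e1 : k'⁻¹ * k' ^ (N + 1) = k' ^ N := by rw [pow_succ', inv_mul_cancel_left]
    have e2 := hk' 1
    rw [pow_one, pow_one] at e2
    rw [gromovProduct_orbit, e1, e2, hk', hk']
    have := hgr N
    linarith
  have h2 := hsucc k fun _ => rfl
  have h3 := hsucc k⁻¹ fun n => by rw [inv_pow, displacement_inv]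
  -- If both limits agreed, the chain kx, k^(N+1)x, k^(-N-1)x, k⁻¹x would give (kx, k⁻¹x)_x ≥ |k|/2
  -- - δ. But this product is |k| - |k²|/2 ≤ |k|/2 - 2δ.
  have h4 := hX.min_le (k • x) (k ^ (N + 1) • x) (k⁻¹ ^ (N + 1) • x) x
  have h5 := hX.min_le (k • x) (k⁻¹ ^ (N + 1) • x) (k⁻¹ • x) x
  rw [gromovProduct_comm _ (k⁻¹ • x)] at h5
  have h6 := le_min h2 h1
  have h7 : (displacement x k + e) / 2 - δ ≤ min (gromovProduct (k • x) (k⁻¹ ^ (N + 1) • x) x)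
      (gromovProduct (k⁻¹ • x) (k⁻¹ ^ (N + 1) • x) x) := le_min (by linarith) (by linarith)
  have h8 : gromovProduct (k • x) (k⁻¹ • x) x = (2 * displacement x k - displacement x (k ^ 2)) / 2 := by
    rw [gromovProduct_orbit, displacement_inv, ← displacement_inv x (k ^ 2)]
    rw [show (k ^ 2)⁻¹ = k⁻¹ * k⁻¹ by group]
    ring
  linarith

end Displacement

/-! ### Invariance under equivalence -/

section Equivalence

variable {G : Type u} [Group G]

theorem actsHyperbolically_iff (X : HypGSpace G) (x : X.carrier) (g : G) :
    ActsHyperbolically X g ↔ LinearGrowth x g :=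
  ⟨fun h => (linearGrowth_iff x g).2 (h x),
    fun h y => (linearGrowth_iff y g).1 (h.of_dist y)⟩

/-- Coarse equivariance compares the displacement of `f x` with d(f x, f(kx)) up to a constant, and
the two-sided estimate on f then transfers linear growth both ways. Both directions are needed, as
`Equivalent` is symmetrized. -/
theorem CoarselyEmbeds.actsHyperbolically_iff {X Y : HypGSpace G} (h : CoarselyEmbeds X Y)
    (g : G) : ActsHyperbolically X g ↔ ActsHyperbolically Y g := by
  obtain ⟨f, ⟨K, C, hK, hC, hf⟩, D, hD⟩ := h
  obtain ⟨x⟩ := X.isHyperbolic.1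
  rw [HoroEq.actsHyperbolically_iff X x, HoroEq.actsHyperbolically_iff Y (f x)]
  have hK0 : 0 < K := by linarith
  have h1 : ∀ k : G, |dist (f x) (f (k • x)) - displacement (f x) k| ≤ D := by
    intro k
    rw [displacement, dist_comm (f x), dist_comm (f x)]
    exact (abs_dist_sub_le _ _ _).trans (hD k x)
  constructor
  · rintro ⟨L, hL, E, h⟩
    refine ⟨K⁻¹ * L, by positivity, K⁻¹ * E + C + D, fun n => ?_⟩
    have h2 := (abs_le.1 (h1 (g ^ n))).2
    have h3 := (hf x (g ^ n • x)).1
    have h4 := mul_le_mul_of_nonneg_left (h n) (inv_nonneg.2 hK0.le)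
    rw [displacement] at h4
    linarith
  · rintro ⟨L, hL, E, h⟩
    refine ⟨K⁻¹ * L, by positivity, K⁻¹ * (E + C + D), fun n => ?_⟩
    have h2 := (abs_le.1 (h1 (g ^ n))).1
    have h3 := (hf x (g ^ n • x)).2
    have h4 := h n
    rw [displacement]
    have h5 : K * (K⁻¹ * L * n - K⁻¹ * (E + C + D)) = L * n - (E + C + D) := by
      field_simp
    refine le_of_mul_le_mul_left ?_ hK0
    rw [h5]
    linarith

theorem Equivalent.actsHyperbolically_iff {X Y : HypGSpace G} (h : Equivalent X Y) (g : G) :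
    ActsHyperbolically X g ↔ ActsHyperbolically Y g := by
  induction h with
  | rel _ _ h => exact h.actsHyperbolically_iff g
  | refl => exact Iff.rfl
  | symm _ _ _ ih => exact ih.symm
  | trans _ _ _ _ _ ih1 ih2 => exact ih1.trans ih2

theorem point_coarselyEmbeds {X : HypGSpace G} (x : X.carrier) {R : ℝ}
    (h : ∀ g : G, displacement x g ≤ R) : CoarselyEmbeds (point G) X := by
  refine ⟨fun _ => x, ⟨1, 0, le_rfl, le_rfl, fun a b => ?_⟩, R, fun g _ => h g⟩
  have : dist a b = 0 := rfl
  simp [this]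

theorem HypGSpace.exists_displacement_mul_le_max (X : HypGSpace G) (x : X.carrier)
    (h : ∀ g : G, ¬ ActsHyperbolically X g) :
    ∃ C > 0, ∀ g k : G,
      displacement x (g * k) ≤ max (displacement x g) (displacement x k) + C := by
  obtain ⟨δ, hδ, hX⟩ := X.exists_fourPoint
  exact HoroEq.exists_displacement_mul_le_max hX hδ x
    fun g hg => h g ((HoroEq.actsHyperbolically_iff X x g).2 hg)

/-- A bounded orbit makes the inclusion of a point coarsely equivariant; an unbounded one converges
to a fixed boundary point. -/
theorem isElementary_of_not_actsHyperbolically (X : HypGSpace G)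
    (h : ∀ g : G, ¬ ActsHyperbolically X g) : IsElementary X := by
  obtain ⟨x⟩ := X.isHyperbolic.1
  obtain ⟨C, -, hC⟩ := X.exists_displacement_mul_le_max x h
  by_cases hb : ∃ R : ℝ, ∀ g : G, displacement x g ≤ R
  · obtain ⟨R, hR⟩ := hb
    exact Or.inl (.symm _ _ (.rel _ _ (point_coarselyEmbeds x hR)))
  · push Not at hb
    exact Or.inr (exists_fixed_boundary_point hC hb)

theorem not_actsHyperbolically_of_subsingleton_boundary {X Y : HypGSpace G} (h : Equivalent X Y)
    (hY : Subsingleton (Boundary Y.carrier)) (g : G) : ¬ ActsHyperbolically X g := by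
  rw [h.actsHyperbolically_iff]
  intro hg
  obtain ⟨δ, hδ, hX⟩ := Y.exists_fourPoint
  obtain ⟨y⟩ := Y.isHyperbolic.1
  exact hX.not_subsingleton_boundary hδ ((actsHyperbolically_iff Y y g).1 hg) hY

end Equivalence

/-! ### Geodesics -/

section Geodesic

variable {X : Type*} [MetricSpace X]

/-- `x` and `y` are joined by a geodesic. -/
def AreJoined (x y : X) : Prop := ∃ c : ℝ → X, IsGeodesicFromTo c x y

theorem areJoined_of_isometry (P : ℝ → X) {s t : ℝ} (hst : s ≤ t)
    (h : ∀ r ∈ Set.Icc s t, ∀ r' ∈ Set.Icc s t, dist (P r) (P r') = |r - r'|) :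
    AreJoined (P s) (P t) := by
  have hd : dist (P s) (P t) = t - s := by
    rw [h s ⟨le_rfl, hst⟩ t ⟨hst, le_rfl⟩, abs_sub_comm, abs_of_nonneg (sub_nonneg.2 hst)]
  refine ⟨fun r => P (s + r), by simp, by simp [hd], fun r hr r' hr' => ?_⟩
  rw [hd] at hr hr'
  have h1 := h (s + r) ⟨by linarith [hr.1], by linarith [hr.2]⟩ (s + r')
    ⟨by linarith [hr'.1], by linarith [hr'.2]⟩
  simpa using h1

theorem AreJoined.refl (x : X) : AreJoined x x :=
  areJoined_of_isometry (fun _ => x) (le_refl (0 : ℝ)) fun r hr r' hr' => by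
    rw [le_antisymm hr.2 hr.1, le_antisymm hr'.2 hr'.1]
    simp

theorem AreJoined.symm {x y : X} (h : AreJoined x y) : AreJoined y x := by
  obtain ⟨c, h0, h1, h⟩ := h
  refine ⟨fun t => c (dist x y - t), by simpa using h1, by simpa [dist_comm y x] using h0, ?_⟩
  intro s hs t ht
  rw [dist_comm y x] at hs ht
  rw [h _ ⟨by linarith [hs.2], by linarith [hs.1]⟩ _ ⟨by linarith [ht.2], by linarith [ht.1]⟩,
    abs_sub_comm]
  congr 1
  ring

/-- The concatenation is geodesic when y lies between x and z: a shortcut between the two pieces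
would shorten the way from x to z. -/
theorem AreJoined.trans {x y z : X} (h : AreJoined x y) (h' : AreJoined y z)
    (hd : dist x y + dist y z ≤ dist x z) : AreJoined x z := by
  have hd' : dist x z = dist x y + dist y z := le_antisymm (dist_triangle _ _ _) hd
  obtain ⟨c, hc0, hc1, hc⟩ := h
  obtain ⟨c', hc0', hc1', hc'⟩ := h'
  have hxy : (0 : ℝ) ≤ dist x y := dist_nonneg
  have hyz : (0 : ℝ) ≤ dist y z := dist_nonneg
  have mixed : ∀ s t : ℝ, 0 ≤ s → s ≤ dist x y → dist x y ≤ t → t ≤ dist x y + dist y z →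
      dist (c s) (c' (t - dist x y)) = t - s := by
    intro s t hs0 hs1 ht0 ht1
    have e1 : dist x (c s) = s := by
      rw [← hc0, hc 0 ⟨le_rfl, hxy⟩ s ⟨hs0, hs1⟩, abs_sub_comm, sub_zero, abs_of_nonneg hs0]
    have e2 : dist (c s) y = dist x y - s := by
      have := hc s ⟨hs0, hs1⟩ _ ⟨hxy, le_rfl⟩
      rwa [hc1, abs_sub_comm, abs_of_nonneg (by linarith)] at this
    have hm : t - dist x y ∈ Set.Icc 0 (dist y z) := ⟨by linarith, by linarith⟩
    have e3 : dist y (c' (t - dist x y)) = t - dist x y := by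
      have := hc' 0 ⟨le_rfl, hyz⟩ _ hm
      rwa [hc0', abs_sub_comm, sub_zero, abs_of_nonneg hm.1] at this
    have e4 : dist (c' (t - dist x y)) z = dist x y + dist y z - t := by
      have := hc' _ hm _ ⟨hyz, le_rfl⟩
      rw [hc1', abs_sub_comm, abs_of_nonneg (by linarith)] at this
      linarith
    have t1 := dist_triangle (c s) y (c' (t - dist x y))
    have t2 := dist_triangle4 x (c s) (c' (t - dist x y)) z
    linarith
  refine ⟨fun t => if t ≤ dist x y then c t else c' (t - dist x y), ?_, ?_, ?_⟩
  · simp [hxy, hc0]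
  · simp only
    split_ifs with h
    · have hyz0 : y = z := dist_le_zero.1 (by linarith)
      rw [← hyz0, hc1]
    · rw [hd', add_sub_cancel_left, hc1']
  · intro s hs t ht
    rw [hd'] at hs ht
    simp only
    split_ifs with h1 h2 h2
    · exact hc s ⟨hs.1, h1⟩ t ⟨ht.1, h2⟩
    · push Not at h2
      rw [mixed s t hs.1 h1 h2.le ht.2, abs_sub_comm, abs_of_nonneg (by linarith)]
    · push Not at h1
      rw [dist_comm, mixed t s ht.1 h2 h1.le hs.2, abs_of_nonneg (by linarith)]
    · push Not at h1 h2
      rw [hc' _ ⟨by linarith, by linarith [hs.2]⟩ _ ⟨by linarith, by linarith [ht.2]⟩]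
      congr 1
      ring

end Geodesic

/-! ### The geometric realization of a graph -/

namespace GGraph

variable {G : Type u} [Group G] (Y : GGraph G)

/-- A vertex, as a point of the geometric realization. -/
noncomputable def vertex (v : Y.vert) : Y.realization.carrier :=
  SeparationQuotient.mk (⟨v, v, 0, le_rfl, zero_le_one, Or.inr ⟨rfl, rfl⟩⟩ : Y.Point)

/-- The point of the geometric realization with given parameters. -/
noncomputable def toRealization (p : GraphPoint Y.graph) : Y.realization.carrier :=
  (SeparationQuotient.mk : Y.Point → SeparationQuotient Y.Point) p

variable {Y}

theorem toRealization_surjective : Function.Surjective Y.toRealization :=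
  @SeparationQuotient.surjective_mk Y.Point _

theorem dist_toRealization (p q : GraphPoint Y.graph) :
    dist (Y.toRealization p) (Y.toRealization q) = GraphPoint.pathDist p q :=
  SeparationQuotient.dist_mk (α := Y.Point) p q

theorem smul_vertex (g : G) (v : Y.vert) : g • Y.vertex v = Y.vertex (g • v) := rfl

theorem dist_vertex_vertex (v w : Y.vert) :
    dist (Y.vertex v) (Y.vertex w) = Y.graph.dist v w := by
  refine (dist_toRealization _ _).trans ?_
  unfold GraphPoint.pathDist GraphPoint.vertexDist
  by_cases h : v = w
  · subst h
    simp
  · have : (0 : ℝ) ≤ Y.graph.dist v w := Nat.cast_nonneg _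
    simp only [h, false_and, if_false, zero_add, sub_zero, add_zero]
    rw [min_eq_left (by linarith : (Y.graph.dist v w : ℝ) ≤ Y.graph.dist v w + 1),
      min_eq_left (by linarith : 1 + (Y.graph.dist v w : ℝ) ≤ 1 + Y.graph.dist v w + 1),
      min_eq_left (by linarith)]

theorem dist_toRealization_vertex_le (p : GraphPoint Y.graph) (b : Bool) :
    dist (Y.toRealization p) (Y.vertex (p.endpoint b)) ≤ p.wt b := by
  refine (dist_toRealization _ _).trans_le ?_
  refine (GraphPoint.pathDist_le_vertexDist _ _).trans ?_
  refine (GraphPoint.vertexDist_le _ _ b true).trans ?_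
  simp [GraphPoint.endpoint, GraphPoint.wt]

theorem toRealization_eq_vertex (p : GraphPoint Y.graph) (b : Bool) (h : p.wt b = 0) :
    Y.toRealization p = Y.vertex (p.endpoint b) :=
  dist_le_zero.1 ((dist_toRealization_vertex_le p b).trans h.le)

/-- The parametrization of an edge. -/
noncomputable def edge {a b : Y.vert} (h : Y.graph.Adj a b) (t : ℝ) : Y.realization.carrier :=
  Y.toRealization ⟨a, b, Set.projIcc 0 1 zero_le_one t,
    (Set.projIcc (0 : ℝ) 1 zero_le_one t).2.1, (Set.projIcc (0 : ℝ) 1 zero_le_one t).2.2, Or.inl h⟩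

theorem edge_eq {a b : Y.vert} (h : Y.graph.Adj a b) {t : ℝ} (h0 : 0 ≤ t) (h1 : t ≤ 1) :
    edge h t = Y.toRealization ⟨a, b, t, h0, h1, Or.inl h⟩ := by
  unfold edge
  congr 2
  rw [Set.projIcc_of_mem zero_le_one ⟨h0, h1⟩]

theorem areJoined_edge {a b : Y.vert} (h : Y.graph.Adj a b) {s t : ℝ} (hs : s ∈ Set.Icc (0 : ℝ) 1)
    (ht : t ∈ Set.Icc (0 : ℝ) 1) : AreJoined (edge h s) (edge h t) := by
  have key : ∀ s ∈ Set.Icc (0 : ℝ) 1, ∀ t ∈ Set.Icc (0 : ℝ) 1, s ≤ t →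
      AreJoined (edge h s) (edge h t) := by
    intro s hs t ht hst
    refine areJoined_of_isometry (edge h) hst fun r hr r' hr' => ?_
    rw [edge_eq h (hs.1.trans hr.1) (hr.2.trans ht.2),
      edge_eq h (hs.1.trans hr'.1) (hr'.2.trans ht.2), dist_toRealization]
    simp [GraphPoint.pathDist]
  rcases le_total s t with hst | hst
  · exact key s hs t ht hst
  · exact (key t ht s hs hst).symm

theorem edge_zero {a b : Y.vert} (h : Y.graph.Adj a b) : edge h 0 = Y.vertex a := by
  rw [edge_eq h le_rfl zero_le_one]
  exact toRealization_eq_vertex _ true rfl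

theorem edge_one {a b : Y.vert} (h : Y.graph.Adj a b) : edge h 1 = Y.vertex b := by
  rw [edge_eq h zero_le_one le_rfl]
  exact toRealization_eq_vertex _ false (sub_self 1)

theorem edge_symm {a b : Y.vert} (h : Y.graph.Adj a b) {t : ℝ} (ht : t ∈ Set.Icc (0 : ℝ) 1) :
    edge h.symm t = edge h (1 - t) := by
  rw [edge_eq h.symm ht.1 ht.2, edge_eq h (by linarith [ht.2]) (by linarith [ht.1])]
  refine dist_le_zero.1 ((dist_toRealization _ _).trans_le ?_)
  simp [GraphPoint.pathDist, h.ne.symm]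

theorem exists_edge_or_vertex (p : GraphPoint Y.graph) :
    (∃ (h : Y.graph.Adj p.src p.tgt), Y.toRealization p = edge h p.t) ∨
      (p.src = p.tgt ∧ Y.toRealization p = Y.vertex p.src) := by
  rcases p.adj with h | ⟨h1, h2⟩
  · exact Or.inl ⟨h, (edge_eq h p.nonneg p.le_one).symm⟩
  · exact Or.inr ⟨h1, toRealization_eq_vertex p true h2⟩

theorem areJoined_endpoint (p : GraphPoint Y.graph) (b : Bool) :
    AreJoined (Y.toRealization p) (Y.vertex (p.endpoint b)) := by
  rcases exists_edge_or_vertex p with ⟨h, hp⟩ | ⟨h, hp⟩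
  · rw [hp]
    cases b
    · have := areJoined_edge h ⟨p.nonneg, p.le_one⟩ ⟨zero_le_one, le_rfl⟩
      rwa [edge_one] at this
    · have := areJoined_edge h ⟨p.nonneg, p.le_one⟩ ⟨le_rfl, zero_le_one⟩
      rwa [edge_zero] at this
  · rw [hp]
    cases b
    · simp only [GraphPoint.endpoint, cond_false, ← h]
      exact AreJoined.refl _
    · exact AreJoined.refl _

theorem areJoined_vertex_of_walk {v w : Y.vert} (p : Y.graph.Walk v w)
    (hp : p.length = Y.graph.dist v w) : AreJoined (Y.vertex v) (Y.vertex w) := by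
  induction p with
  | nil => exact AreJoined.refl _
  | @cons a b c h p ih =>
    have h1 : Y.graph.dist a b = 1 := SimpleGraph.dist_eq_one_iff_adj.2 h
    have h2 := Y.connected.dist_triangle (u := a) (v := b) (w := c)
    have h3 := SimpleGraph.dist_le p
    rw [SimpleGraph.Walk.length_cons] at hp
    have hab : AreJoined (Y.vertex a) (Y.vertex b) := by
      have := areJoined_edge h ⟨le_rfl, zero_le_one⟩ ⟨zero_le_one, le_rfl⟩
      rwa [edge_zero, edge_one] at this
    refine hab.trans (ih (by omega)) ?_
    simp only [dist_vertex_vertex]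
    exact_mod_cast (by omega : Y.graph.dist a b + Y.graph.dist b c ≤ Y.graph.dist a c)

theorem areJoined_vertex (v w : Y.vert) : AreJoined (Y.vertex v) (Y.vertex w) := by
  obtain ⟨p, hp⟩ := Y.connected.exists_walk_length_eq_dist v w
  exact areJoined_vertex_of_walk p hp

/-- Off a common edge, the distance is attained through a pair of endpoints, and equality in the
triangle inequality allows partial edge, vertex geodesic and partial edge to be concatenated. -/
theorem isGeodesicSpace_realization : IsGeodesicSpace Y.realization.carrier := by
  intro x y
  obtain ⟨p, rfl⟩ := toRealization_surjective x
  obtain ⟨q, rfl⟩ := toRealization_surjective y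
  change AreJoined _ _
  have same_edge : ∀ p q : GraphPoint Y.graph, p.src = q.src → p.tgt = q.tgt →
      AreJoined (Y.toRealization p) (Y.toRealization q) := by
    rintro ⟨a, b, s, hs0, hs1, h⟩ ⟨a', b', t, ht0, ht1, h'⟩ (rfl : a = a') (rfl : b = b')
    rcases h with h | ⟨rfl, rfl⟩
    · rw [← edge_eq h hs0 hs1, ← edge_eq h ht0 ht1]
      exact areJoined_edge h ⟨hs0, hs1⟩ ⟨ht0, ht1⟩
    · rcases h' with h' | ⟨-, rfl⟩
      · exact absurd rfl h'.ne
      · exact AreJoined.refl _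
  by_cases h1 : p.src = q.src ∧ p.tgt = q.tgt
  · exact same_edge p q h1.1 h1.2
  by_cases h2 : p.src = q.tgt ∧ p.tgt = q.src
  · rcases exists_edge_or_vertex q with ⟨h, hq⟩ | ⟨h, -⟩
    · have e : edge h q.t = edge h.symm (1 - q.t) := by
        rw [edge_symm h ⟨by linarith [q.le_one], by linarith [q.nonneg]⟩, sub_sub_cancel]
      rw [hq, e, edge_eq h.symm (by linarith [q.le_one]) (by linarith [q.nonneg])]
      exact same_edge _ _ h2.1 h2.2
    · exact absurd ⟨h2.1.trans h.symm, h2.2.trans h⟩ h1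
  obtain ⟨b, c, h⟩ := GraphPoint.exists_vertexDist p q
  have hd : dist (Y.toRealization p) (Y.toRealization q) = GraphPoint.vertexDist p q := by
    rw [dist_toRealization, GraphPoint.pathDist, if_neg h1, if_neg h2]
  rw [h, ← dist_vertex_vertex] at hd
  have hp := dist_toRealization_vertex_le p b
  have hq := dist_toRealization_vertex_le q c
  rw [dist_comm] at hq
  have hpc := dist_triangle (Y.toRealization p) (Y.vertex (p.endpoint b))
    (Y.vertex (q.endpoint c))
  have hpq := dist_triangle (Y.toRealization p) (Y.vertex (q.endpoint c)) (Y.toRealization q)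
  exact ((areJoined_endpoint p b).trans (areJoined_vertex _ _) (by linarith)).trans
    (areJoined_endpoint q c).symm (by linarith)

theorem exists_vertex_dist_le_one (x : Y.realization.carrier) :
    ∃ v, dist x (Y.vertex v) ≤ 1 := by
  obtain ⟨p, rfl⟩ := toRealization_surjective x
  exact ⟨_, (dist_toRealization_vertex_le p true).trans p.le_one⟩

/-- Replacing each point by a vertex at distance at most 1 changes each of the four distances in
play by at most 2, whence the 8. -/
theorem fourPoint_realization {k : ℝ} (h : ∀ a b c d : Y.vert,
    (Y.graph.dist a c : ℝ) + Y.graph.dist b d ≤ max ((Y.graph.dist a b : ℝ) + Y.graph.dist c d)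
      ((Y.graph.dist a d : ℝ) + Y.graph.dist b c) + k) :
    FourPoint Y.realization.carrier ((k + 8) / 2) := by
  intro x y z w
  obtain ⟨a, ha⟩ := exists_vertex_dist_le_one x
  obtain ⟨b, hb⟩ := exists_vertex_dist_le_one y
  obtain ⟨c, hc⟩ := exists_vertex_dist_le_one z
  obtain ⟨d, hd⟩ := exists_vertex_dist_le_one w
  have key := h a b c d
  simp only [← dist_vertex_vertex] at key
  have near : ∀ {p q : Y.realization.carrier} {v w : Y.vert}, dist p (Y.vertex v) ≤ 1 →
      dist q (Y.vertex w) ≤ 1 → dist p q ≤ dist (Y.vertex v) (Y.vertex w) + 2 ∧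
        dist (Y.vertex v) (Y.vertex w) ≤ dist p q + 2 := by
    intro p q v w hp hq
    have h1 := dist_triangle4 p (Y.vertex v) (Y.vertex w) q
    have h2 := dist_triangle4 (Y.vertex v) p q (Y.vertex w)
    rw [dist_comm (Y.vertex w)] at h1
    rw [dist_comm (Y.vertex v) p] at h2
    constructor <;> linarith
  have h1 := (near ha hc).1
  have h2 := (near hb hd).1
  have h3 := (near ha hb).2
  have h4 := (near hc hd).2
  have h5 := (near ha hd).2
  have h6 := (near hb hc).2
  have h7 := le_max_left (dist x y + dist z w) (dist x w + dist y z)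
  have h8 := le_max_right (dist x y + dist z w) (dist x w + dist y z)
  rcases max_choice (dist (Y.vertex a) (Y.vertex b) + dist (Y.vertex c) (Y.vertex d))
    (dist (Y.vertex a) (Y.vertex d) + dist (Y.vertex b) (Y.vertex c)) with h9 | h9 <;>
    rw [h9] at key <;> linarith

theorem isHyperbolic_realization {k : ℝ} (hk : 0 ≤ k) (h : ∀ a b c d : Y.vert,
    (Y.graph.dist a c : ℝ) + Y.graph.dist b d ≤ max ((Y.graph.dist a b : ℝ) + Y.graph.dist c d)
      ((Y.graph.dist a d : ℝ) + Y.graph.dist b c) + k) : Y.realization.IsHyperbolic := by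
  obtain ⟨v⟩ := Y.connected.nonempty
  exact ⟨⟨Y.vertex v⟩, isGeodesicSpace_realization, _,
    (fourPoint_realization h).hasThinTriangles (by linarith)⟩

/-- A coarsely equivariant quasi-isometric embedding of the vertices extends to the
realization. -/
theorem coarselyEmbeds_of_vertices (hY : Y.realization.IsHyperbolic) {X : HypGSpace G}
    (f : Y.vert → X.carrier) {K C : ℝ} (hK : 1 ≤ K) (hC : 0 ≤ C)
    (hl : ∀ v w, K⁻¹ * Y.graph.dist v w - C ≤ dist (f v) (f w))
    (hu : ∀ v w, dist (f v) (f w) ≤ K * Y.graph.dist v w + C)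
    (hf : ∀ (g : G) (v : Y.vert), f (g • v) = g • f v) :
    CoarselyEmbeds ⟨Y.realization, hY⟩ X := by
  choose r hr using exists_vertex_dist_le_one (Y := Y)
  have hK0 : 0 < K := by linarith
  have hK1 : K⁻¹ ≤ 1 := inv_le_one_of_one_le₀ hK
  have hK2 : 0 ≤ K⁻¹ := by positivity
  refine ⟨fun p => f (r p), ⟨K, C + 2 * K, hK, by positivity, fun p q => ?_⟩, 2 * K + C,
    fun g p => ?_⟩
  · have h1 := dist_triangle4 p (Y.vertex (r p)) (Y.vertex (r q)) q
    have h2 := dist_triangle4 (Y.vertex (r p)) p q (Y.vertex (r q))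
    rw [dist_comm (Y.vertex (r q)) q] at h1
    rw [dist_comm (Y.vertex (r p)) p] at h2
    have hp := hr p
    have hq := hr q
    rw [dist_vertex_vertex] at h1 h2
    have h3 := hl (r p) (r q)
    have h4 := hu (r p) (r q)
    have h5 : K⁻¹ * dist p q ≤ K⁻¹ * (Y.graph.dist (r p) (r q) + 2) := by
      gcongr
      linarith
    have h6 : K * Y.graph.dist (r p) (r q) ≤ K * (dist p q + 2) := by
      gcongr
      linarith
    constructor <;> linarith
  · rw [← hf]
    refine (hu _ _).trans ?_
    -- The chosen nearby vertices are not equivariant, but `r (g • p)` and `g • r p` are both within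
    -- 1 of `g • p`.
    have h1 : dist (Y.vertex (r (g • p))) (Y.vertex (g • r p)) ≤ 2 := by
      have h2 := dist_triangle_left (Y.vertex (r (g • p))) (Y.vertex (g • r p)) (g • p)
      rw [← smul_vertex, dist_smul] at h2
      rw [← smul_vertex]
      linarith [hr (g • p), hr p]
    rw [dist_vertex_vertex] at h1
    have := mul_le_mul_of_nonneg_left h1 hK0.le
    linarith

end GGraph

/-! ### Distances in combinatorial horoballs -/

theorem pnat_le_induction {P : ℕ+ → Prop} {n : ℕ+} (h0 : P n) (hs : ∀ m, n ≤ m → P m → P (m + 1))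
    (m : ℕ+) (hm : n ≤ m) : P m := by
  induction m using PNat.recOn with
  | one => rwa [← le_antisymm hm one_le]
  | succ m ih =>
    rcases hm.eq_or_lt with h | h
    · rwa [← h]
    · have := PNat.lt_add_one_iff.1 h
      exact hs m this (ih this)

section HoroballGraph

variable {V : Type u} {B : ℕ+ → V → Set V}

theorem horoballGraph_adj_vertical (v : V) (n : ℕ+) :
    (horoballGraph B).Adj (v, n) (v, n + 1) := by
  rw [horoballGraph, SimpleGraph.fromRel_adj]
  refine ⟨fun h => ?_, Or.inl (Or.inl ⟨rfl, rfl⟩)⟩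
  have h2 := congrArg (fun p : V × ℕ+ => (p.2 : ℕ)) h
  simp at h2

theorem horoballGraph_eq_or_adj {v w : V} {n : ℕ+} (h : v ∈ B n w) :
    (v, n) = (w, n) ∨ (horoballGraph B).Adj (v, n) (w, n) := by
  by_cases hvw : v = w
  · exact Or.inl (by rw [hvw])
  · rw [horoballGraph, SimpleGraph.fromRel_adj]
    exact Or.inr ⟨fun he => hvw (congrArg Prod.fst he), Or.inl (Or.inr ⟨rfl, h⟩)⟩

theorem horoballGraph_adj_cases {p q : V × ℕ+} (h : (horoballGraph B).Adj p q) :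
    (p.1 = q.1 ∧ ((q.2 : ℕ) = p.2 + 1 ∨ (p.2 : ℕ) = q.2 + 1)) ∨
      (p.2 = q.2 ∧ (p.1 ∈ B p.2 q.1 ∨ q.1 ∈ B p.2 p.1)) := by
  rw [horoballGraph, SimpleGraph.fromRel_adj] at h
  rcases h.2 with (⟨h1, h2⟩ | ⟨h1, h2⟩) | (⟨h1, h2⟩ | ⟨h1, h2⟩)
  · exact Or.inl ⟨h1, Or.inl (by rw [h2]; rfl)⟩
  · exact Or.inr ⟨h1, Or.inl h2⟩
  · exact Or.inl ⟨h1.symm, Or.inr (by rw [h2]; rfl)⟩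
  · exact Or.inr ⟨h1.symm, Or.inr (h1 ▸ h2)⟩

theorem height_le_of_walk {p q : V × ℕ+} (c : (horoballGraph B).Walk p q) :
    (p.2 : ℕ) ≤ q.2 + c.length := by
  induction c with
  | nil => simp
  | cons h c ih =>
    rw [SimpleGraph.Walk.length_cons]
    rcases horoballGraph_adj_cases h with ⟨-, h | h⟩ | ⟨h, -⟩
    · omega
    · omega
    · rw [h]
      omega

variable (hc : (horoballGraph B).Connected)
include hc

theorem height_le_add_dist (p q : V × ℕ+) :
    (p.2 : ℕ) ≤ q.2 + (horoballGraph B).dist p q := by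
  obtain ⟨c, h⟩ := hc.exists_walk_length_eq_dist p q
  rw [← h]
  exact height_le_of_walk c

theorem dist_vertical_le (v : V) {n m : ℕ+} (h : n ≤ m) :
    (n : ℕ) + (horoballGraph B).dist (v, n) (v, m) ≤ m := by
  refine pnat_le_induction (P := fun m => (n : ℕ) + (horoballGraph B).dist (v, n) (v, m) ≤ m)
    ?_ ?_ m h
  · simp
  · intro m _ ih
    have h1 := hc.dist_triangle (u := (v, n)) (v := (v, m)) (w := (v, m + 1))
    rw [SimpleGraph.dist_eq_one_iff_adj.2 (horoballGraph_adj_vertical v m)] at h1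
    rw [PNat.add_coe, PNat.one_coe]
    omega

/-- Go up to height N, across one horizontal edge, and down. The additive form avoids truncated
subtraction. -/
theorem dist_horoball_le {v w : V} {n m N : ℕ+} (hn : n ≤ N) (hm : m ≤ N) (h : v ∈ B N w) :
    (n : ℕ) + m + (horoballGraph B).dist (v, n) (w, m) ≤ 2 * N + 1 := by
  have h1 := dist_vertical_le hc v hn
  have h2 := dist_vertical_le hc w hm
  have h3 : (horoballGraph B).dist (v, N) (w, N) ≤ 1 := by
    rcases horoballGraph_eq_or_adj h with he | he
    · rw [he, SimpleGraph.dist_self]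
      exact zero_le_one
    · exact (SimpleGraph.dist_eq_one_iff_adj.2 he).le
  have h4 := hc.dist_triangle (u := (v, n)) (v := (v, N)) (w := (w, m))
  have h5 := hc.dist_triangle (u := (v, N)) (v := (w, N)) (w := (w, m))
  rw [SimpleGraph.dist_comm (u := (w, m))] at h2
  omega

end HoroballGraph

/-! ### The boundary of a combinatorial horoball -/

section Boundary

variable {G : Type u} [Group G] {Y : GGraph G} {B : ℕ+ → Y.vert → Set Y.vert}

theorem Admissible.self_mem_one (hB : Admissible Y B) (v : Y.vert) : v ∈ B 1 v := by
  rw [hB.connectedness]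
  simp

/-- Exponential growth with both vertices equal to v gives the inclusion once v ∈ B_m(v), which is
carried along in the induction. -/
theorem Admissible.mono (hB : Admissible Y B) (v : Y.vert) {n m : ℕ+} (h : n ≤ m) :
    B n v ⊆ B m v := by
  have key : ∀ m : ℕ+, v ∈ B m v ∧ B m v ⊆ B (m + 1) v := by
    intro m
    induction m using PNat.recOn with
    | one => exact ⟨hB.self_mem_one v, hB.exponential_growth _ _ _ (hB.self_mem_one v)⟩
    | succ m ih =>
      have := ih.2 ih.1
      exact ⟨this, hB.exponential_growth _ _ _ this⟩
  exact pnat_le_induction (P := fun m => B n v ⊆ B m v) Set.Subset.rfl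
    (fun m _ ih => Set.Subset.trans ih (key m).2) m h

/-- Each edge of the walk costs one level: neighbours of a lie in B_1(a) ⊆ B_N(a) ⊆ B_{N+1}(w). -/
theorem Admissible.exists_mem_of_walk (hB : Admissible Y B) {u v : Y.vert}
    (c : Y.graph.Walk u v) (w : Y.vert) (N : ℕ+) (h : u ∈ B N w) : ∃ N', v ∈ B N' w := by
  induction c generalizing N with
  | nil => exact ⟨N, h⟩
  | @cons a b _ hab _ ih =>
    refine ih (N + 1) (hB.exponential_growth _ _ _ h (hB.mono a one_le ?_))
    rw [hB.connectedness]
    exact (SimpleGraph.dist_eq_one_iff_adj.2 hab).le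

theorem Admissible.exists_forall_mem (hB : Admissible Y B) (v w : Y.vert) :
    ∃ N, ∀ M ≥ N, v ∈ B M w := by
  obtain ⟨c⟩ := Y.connected.preconnected w v
  obtain ⟨N, hN⟩ := hB.exists_mem_of_walk c w 1 (hB.self_mem_one w)
  exact ⟨N, fun M hM => hB.mono w hM hN⟩

/-- A vertex of a combinatorial horoball, as a point of its realization. -/
noncomputable def horoballPoint (hB : Admissible Y B) (p : Y.vert × ℕ+) :
    (horoball Y B hB).realization.carrier :=
  (horoball Y B hB).vertex p

theorem dist_horoballPoint (hB : Admissible Y B) (p q : Y.vert × ℕ+) :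
    dist (horoballPoint hB p) (horoballPoint hB q) = (horoballGraph B).dist p q :=
  GGraph.dist_vertex_vertex (Y := horoball Y B hB) p q

/-- For M large, (w, M) is reached from near x by climbing and one horizontal step, so the Gromov
product of x with (w, M) is at least half the distance from x to o, up to a constant. Two far points
therefore have a large product with a common high point, hence with each other. -/
theorem subsingleton_boundary_horoball (hB : Admissible Y B)
    (hH : (horoball Y B hB).realization.IsHyperbolic) :
    Subsingleton (Boundary (horoball Y B hB).realization.carrier) := by
  obtain ⟨δ, hδ, hX⟩ := HypGSpace.exists_fourPoint ⟨_, hH⟩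
  have hc : (horoballGraph B).Connected := (horoball Y B hB).connected
  obtain ⟨w⟩ := Y.connected.nonempty
  set o := horoballPoint hB (w, 1) with ho
  have key : ∀ x : (horoball Y B hB).realization.carrier, ∃ N : ℕ+, ∀ M ≥ N,
      dist x o / 2 - 2 ≤ gromovProduct x (horoballPoint hB (w, M)) o := by
    intro x
    obtain ⟨v, n, hv⟩ : ∃ v n, dist x (horoballPoint hB (v, n)) ≤ 1 := by
      obtain ⟨⟨v, n⟩, hv⟩ := GGraph.exists_vertex_dist_le_one x
      exact ⟨v, n, hv⟩
    obtain ⟨N, hN⟩ := hB.exists_forall_mem v w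
    refine ⟨max N n, fun M hM => ?_⟩
    have h1 := dist_horoball_le hc ((le_max_right N n).trans hM) (le_refl M)
      (hN M ((le_max_left N n).trans hM))
    have h2 := height_le_add_dist hc (w, M) (w, 1)
    have h3 : 1 ≤ (n : ℕ) := n.pos
    have h1' : (n : ℝ) + M + (horoballGraph B).dist (v, n) (w, M) ≤ 2 * M + 1 := by
      exact_mod_cast h1
    have h2' : (M : ℝ) ≤ 1 + (horoballGraph B).dist (w, M) (w, 1) := by
      exact_mod_cast h2
    have h3' : (1 : ℝ) ≤ n := by exact_mod_cast h3
    have h4 := dist_triangle x (horoballPoint hB (v, n)) (horoballPoint hB (w, M))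
    rw [dist_horoballPoint] at h4
    rw [gromovProduct, ho, dist_horoballPoint]
    linarith
  refine subsingleton_boundary fun x y hx hy => seqEquiv_of_le o fun R => ?_
  obtain ⟨N, hN⟩ := hx.exists_le_dist o (2 * (R + δ + 2))
  obtain ⟨N', hN'⟩ := hy.exists_le_dist o (2 * (R + δ + 2))
  refine ⟨max N N', fun i hi j hj => ?_⟩
  have h1 := hN i ((le_max_left _ _).trans hi)
  have h2 := hN' j ((le_max_right _ _).trans hj)
  obtain ⟨M, hM⟩ := key (x i)
  obtain ⟨M', hM'⟩ := key (y j)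
  have h3 := hM (max M M') (le_max_left _ _)
  have h4 := hM' (max M M') (le_max_right _ _)
  have h5 := hX.min_le (x i) (horoballPoint hB (w, max M M')) (y j) o
  rw [gromovProduct_comm _ (y j)] at h5
  have h6 : R + δ ≤ min (gromovProduct (x i) (horoballPoint hB (w, max M M')) o)
      (gromovProduct (y j) (horoballPoint hB (w, max M M')) o) :=
    le_min (by linarith) (by linarith)
  linarith

end Boundary

/-! ### Exponential families of balls -/

/-- `ρ` is a pseudometric. -/
structure IsPseudoDist {V : Type*} (ρ : V → V → ℝ) : Prop where
  self : ∀ v, ρ v v = 0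
  symm : ∀ v w, ρ v w = ρ w v
  triangle : ∀ u v w, ρ u w ≤ ρ u v + ρ v w

/-- The balls of radius `2 ^ (n - 1)`. -/
def ballFamily {V : Type*} (ρ : V → V → ℝ) (n : ℕ+) (v : V) : Set V :=
  {w | ρ v w ≤ 2 ^ (n : ℕ) / 2}

section BallFamily

variable {V : Type u} {ρ : V → V → ℝ}

theorem IsPseudoDist.nonneg (hρ : IsPseudoDist ρ) (v w : V) : 0 ≤ ρ v w := by
  have h1 := hρ.triangle v w v
  rw [hρ.self, hρ.symm w v] at h1
  linarith

theorem IsPseudoDist.abs_sub_le (hρ : IsPseudoDist ρ) (a b c : V) :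
    |ρ a c - ρ b c| ≤ ρ a b := by
  have h1 := hρ.triangle a b c
  have h2 := hρ.triangle b a c
  rw [hρ.symm b a] at h2
  exact abs_le.2 ⟨by linarith, by linarith⟩

/-- The exponential of half the distance in the horoball, up to normalization. -/
noncomputable def scale (ρ : V → V → ℝ) (p q : V × ℕ+) : ℝ :=
  max (ρ p.1 q.1) (max (2 ^ (p.2 : ℕ)) (2 ^ (q.2 : ℕ)))

theorem scale_pos (p q : V × ℕ+) : 0 < scale ρ p q :=
  lt_max_of_lt_right (lt_max_of_lt_left (by positivity))

theorem IsPseudoDist.scale_comm (hρ : IsPseudoDist ρ) (p q : V × ℕ+) :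
    scale ρ p q = scale ρ q p := by
  rw [scale, scale, hρ.symm, max_comm (2 ^ (p.2 : ℕ))]

theorem IsPseudoDist.scale_triangle (hρ : IsPseudoDist ρ) (p q r : V × ℕ+) :
    scale ρ p r ≤ scale ρ p q + scale ρ q r := by
  have h1 : ρ p.1 q.1 ≤ scale ρ p q := le_max_left _ _
  have h2 : ρ q.1 r.1 ≤ scale ρ q r := le_max_left _ _
  have h3 : (2 : ℝ) ^ (p.2 : ℕ) ≤ scale ρ p q := (le_max_left _ _).trans (le_max_right _ _)
  have h4 : (2 : ℝ) ^ (r.2 : ℕ) ≤ scale ρ q r := (le_max_right _ _).trans (le_max_right _ _)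
  have h5 := hρ.triangle p.1 q.1 r.1
  have h6 := scale_pos (ρ := ρ) p q
  have h7 := scale_pos (ρ := ρ) q r
  refine max_le (by linarith) (max_le (by linarith) (by linarith))

/-- Ptolemy's inequality up to a factor. -/
theorem IsPseudoDist.scale_ptolemy (hρ : IsPseudoDist ρ) (a b c d : V × ℕ+) :
    scale ρ a c * scale ρ b d ≤
      4 * max (scale ρ a b * scale ρ c d) (scale ρ a d * scale ρ b c) := by
  have pos := scale_pos (ρ := ρ)
  -- When ab is no longer than the sides bc and ad next to it, the triangle inequality gives ac ≤ 2
  -- bc and bd ≤ 2 ad.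
  have main : ∀ a b c d : V × ℕ+, scale ρ a b ≤ scale ρ b c → scale ρ a b ≤ scale ρ a d →
      scale ρ a c * scale ρ b d ≤ 4 * (scale ρ a d * scale ρ b c) := by
    intro a b c d h1 h2
    have h3 := hρ.scale_triangle a b c
    have h4 := hρ.scale_triangle b a d
    rw [hρ.scale_comm b a] at h4
    have h5 : scale ρ a c ≤ 2 * scale ρ b c := by linarith
    have h6 : scale ρ b d ≤ 2 * scale ρ a d := by linarith
    have := mul_le_mul h5 h6 (pos _ _).le (by linarith [pos b c])
    linarith
  -- One instance for each side of the quadrilateral that may be the shortest.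
  have c1 := main a b c d
  have c2 := main c b a d
  have c3 := main c d a b
  have c4 := main a d c b
  rw [hρ.scale_comm c a, hρ.scale_comm c b, hρ.scale_comm b a] at c2
  rw [hρ.scale_comm c a, hρ.scale_comm d b, hρ.scale_comm d a, hρ.scale_comm c b] at c3
  rw [hρ.scale_comm d b, hρ.scale_comm d c] at c4
  have l1 := le_max_left (scale ρ a b * scale ρ c d) (scale ρ a d * scale ρ b c)
  have l2 := le_max_right (scale ρ a b * scale ρ c d) (scale ρ a d * scale ρ b c)
  rcases le_total (scale ρ a b) (scale ρ c d) with h1 | h1 <;>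
    rcases le_total (scale ρ a d) (scale ρ b c) with h2 | h2
  · rcases le_total (scale ρ a b) (scale ρ a d) with h3 | h3
    · linarith [c1 (by linarith) (by linarith)]
    · linarith [c4 (by linarith) (by linarith)]
  · rcases le_total (scale ρ a b) (scale ρ b c) with h3 | h3
    · linarith [c1 (by linarith) (by linarith)]
    · linarith [c2 (by linarith) (by linarith)]
  · rcases le_total (scale ρ c d) (scale ρ a d) with h3 | h3
    · linarith [c3 (by linarith) (by linarith)]
    · linarith [c4 (by linarith) (by linarith)]
  · rcases le_total (scale ρ c d) (scale ρ b c) with h3 | h3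
    · linarith [c3 (by linarith) (by linarith)]
    · linarith [c2 (by linarith) (by linarith)]

/-- Travelling far horizontally in few steps forces the walk to climb. Each step doubles the bound;
a horizontal step at height h has ρ-length at most 2^h / 2, and h is at most the final height plus
the remaining length. -/
theorem IsPseudoDist.sq_le_of_walk (hρ : IsPseudoDist ρ) {p q : V × ℕ+}
    (c : (horoballGraph (ballFamily ρ)).Walk p q) :
    ρ p.1 q.1 ^ 2 ≤ 4 * 2 ^ ((p.2 : ℕ) + q.2 + c.length) := by
  induction c with
  | nil =>
    rw [hρ.self, zero_pow two_ne_zero]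
    positivity
  | @cons p p' q h c ih =>
    rw [SimpleGraph.Walk.length_cons]
    rcases horoballGraph_adj_cases h with ⟨h1, h2⟩ | ⟨h1, h2⟩
    · rw [h1]
      have := pow_le_pow_right₀ (one_le_two (α := ℝ))
        (by omega : (p'.2 : ℕ) + q.2 + c.length ≤ p.2 + q.2 + (c.length + 1))
      linarith
    · have h3 : ρ p.1 p'.1 ≤ 2 ^ (p'.2 : ℕ) / 2 := by
        rw [h1] at h2
        rcases h2 with h2 | h2
        · rw [hρ.symm]
          exact h2
        · exact h2
      have h4 := height_le_of_walk c
      have h5 : ((2 : ℝ) ^ (p'.2 : ℕ)) ^ 2 ≤ 2 ^ ((p'.2 : ℕ) + q.2 + c.length) := by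
        rw [← pow_mul]
        exact pow_le_pow_right₀ one_le_two (by omega)
      rw [h1, ← add_assoc, pow_succ (2 : ℝ)]
      have h6 := hρ.triangle p.1 p'.1 q.1
      have h7 := hρ.nonneg p.1 p'.1
      have h8 := hρ.nonneg p'.1 q.1
      have h9 := hρ.nonneg p.1 q.1
      have h10 : ρ p.1 q.1 ^ 2 ≤ (2 ^ (p'.2 : ℕ) / 2 + ρ p'.1 q.1) ^ 2 := by
        gcongr
        linarith
      -- With r = 2^h / 2, D the remaining ρ-distance and A the bound on D², one has r² ≤ A/16; the
      -- square gives 2rD ≤ D²/4 + 4r², so (r + D)² ≤ 25A/16 ≤ 2A.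
      nlinarith [sq_nonneg (ρ p'.1 q.1 - 4 * (2 ^ (p'.2 : ℕ) / 2))]

/-- N is the least height at which balls have radius at least the scale; minimality bounds 2^N from
above. It is the height at which a nearly shortest path crosses. -/
theorem IsPseudoDist.exists_scale_bound (hρ : IsPseudoDist ρ) (p q : V × ℕ+) :
    ∃ N : ℕ+, p.2 ≤ N ∧ q.2 ≤ N ∧ p.1 ∈ ballFamily ρ N q.1 ∧ (2 : ℝ) ^ (N : ℕ) ≤ 4 * scale ρ p q := by
  have hex : ∃ n : ℕ, scale ρ p q ≤ 2 ^ n / 2 := by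
    obtain ⟨n, hn⟩ := pow_unbounded_of_one_lt (2 * scale ρ p q) (one_lt_two (α := ℝ))
    exact ⟨n, by linarith⟩
  classical
  set N := Nat.find hex with hN
  have h1 : scale ρ p q ≤ 2 ^ N / 2 := Nat.find_spec hex
  have h2 : (2 : ℝ) ^ (p.2 : ℕ) ≤ scale ρ p q := (le_max_left _ _).trans (le_max_right _ _)
  have h3 : (2 : ℝ) ^ (q.2 : ℕ) ≤ scale ρ p q := (le_max_right _ _).trans (le_max_right _ _)
  have h4 : (0 : ℝ) < 2 ^ N := by positivity
  have h5 : (p.2 : ℕ) ≤ N := (pow_le_pow_iff_right₀ (one_lt_two (α := ℝ))).1 (by linarith)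
  have h6 : (q.2 : ℕ) ≤ N := (pow_le_pow_iff_right₀ (one_lt_two (α := ℝ))).1 (by linarith)
  have h7 : 0 < N := p.2.pos.trans_le h5
  refine ⟨⟨N, h7⟩, h5, h6, ?_, ?_⟩
  · change ρ q.1 p.1 ≤ 2 ^ N / 2
    rw [hρ.symm]
    exact (le_max_left _ _).trans h1
  · change (2 : ℝ) ^ N ≤ _
    have h8 := Nat.find_min hex (m := N - 1) (by omega)
    push Not at h8
    obtain ⟨k, hk⟩ : ∃ k, N = k + 1 := ⟨N - 1, by omega⟩
    rw [hk, pow_succ]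
    rw [hk, Nat.add_sub_cancel] at h8
    linarith

theorem IsPseudoDist.connected (hρ : IsPseudoDist ρ) [Nonempty V] :
    (horoballGraph (ballFamily ρ)).Connected := by
  have vertical : ∀ (v : V) (n m : ℕ+), n ≤ m →
      (horoballGraph (ballFamily ρ)).Reachable (v, n) (v, m) := fun v n =>
    pnat_le_induction (SimpleGraph.Reachable.refl _)
      fun m _ ih => ih.trans (horoballGraph_adj_vertical v m).reachable
  refine ⟨fun p q => ?_⟩
  obtain ⟨N, h1, h2, h3, -⟩ := hρ.exists_scale_bound p q
  refine ((vertical p.1 p.2 N h1).trans ?_).trans (vertical q.1 q.2 N h2).symm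
  rcases horoballGraph_eq_or_adj h3 with h | h
  · rw [h]
  · exact h.reachable

/-- The path through that height has length at most 2N + 1 - n - m. With `scale_sq_le` this
determines the distance up to a constant as 2 log₂ of the scale minus both heights. -/
theorem IsPseudoDist.two_pow_dist_le (hρ : IsPseudoDist ρ) [Nonempty V] (p q : V × ℕ+) :
    (2 : ℝ) ^ ((p.2 : ℕ) + q.2 + (horoballGraph (ballFamily ρ)).dist p q) ≤
      32 * scale ρ p q ^ 2 := by
  obtain ⟨N, h1, h2, h3, h4⟩ := hρ.exists_scale_bound p q
  have h5 := dist_horoball_le hρ.connected h1 h2 h3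
  calc (2 : ℝ) ^ ((p.2 : ℕ) + q.2 + (horoballGraph (ballFamily ρ)).dist p q)
      ≤ 2 ^ (2 * (N : ℕ) + 1) := pow_le_pow_right₀ one_le_two h5
    _ = 2 * (2 ^ (N : ℕ)) ^ 2 := by ring
    _ ≤ 2 * (4 * scale ρ p q) ^ 2 := by gcongr
    _ = 32 * scale ρ p q ^ 2 := by ring

theorem IsPseudoDist.scale_sq_le (hρ : IsPseudoDist ρ) [Nonempty V] (p q : V × ℕ+) :
    scale ρ p q ^ 2 ≤
      4 * 2 ^ ((p.2 : ℕ) + q.2 + (horoballGraph (ballFamily ρ)).dist p q) := by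
  have hc := hρ.connected
  have hpow : ∀ n k : ℕ, 2 * n ≤ k → ((2 : ℝ) ^ n) ^ 2 ≤ 4 * 2 ^ k := by
    intro n k h
    rw [← pow_mul]
    have : (2 : ℝ) ^ (n * 2) ≤ 2 ^ k := pow_le_pow_right₀ one_le_two (by omega)
    have : (0 : ℝ) < 2 ^ k := by positivity
    linarith
  have h1 := height_le_add_dist hc p q
  have h2 := height_le_add_dist hc q p
  rw [SimpleGraph.dist_comm] at h2
  rw [scale]
  rcases max_choice (ρ p.1 q.1) (max (2 ^ (p.2 : ℕ)) (2 ^ (q.2 : ℕ))) with h | h <;> rw [h]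
  · obtain ⟨c, hc'⟩ := hc.exists_walk_length_eq_dist p q
    rw [← hc']
    exact hρ.sq_le_of_walk c
  · rcases max_choice ((2 : ℝ) ^ (p.2 : ℕ)) (2 ^ (q.2 : ℕ)) with h' | h' <;> rw [h']
    · exact hpow _ _ (by omega)
    · exact hpow _ _ (by omega)

/-- The heights cancel, and 7 = log₂(32 · 4) collects the errors of the two comparisons. -/
theorem IsPseudoDist.dist_le_of_scale_le (hρ : IsPseudoDist ρ) [Nonempty V] {V' : Type u}
    [Nonempty V'] {ρ' : V' → V' → ℝ} (hρ' : IsPseudoDist ρ') {p q : V × ℕ+} {p' q' : V' × ℕ+}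
    (hp : p.2 = p'.2) (hq : q.2 = q'.2) (h : scale ρ p q ≤ scale ρ' p' q') :
    ((horoballGraph (ballFamily ρ)).dist p q : ℝ) ≤
      (horoballGraph (ballFamily ρ')).dist p' q' + 7 := by
  have h1 := hρ.two_pow_dist_le p q
  have h2 := hρ'.scale_sq_le p' q'
  have h3 := pow_le_pow_left₀ (scale_pos p q).le h 2
  have h4 : (2 : ℝ) ^ ((p.2 : ℕ) + q.2 + (horoballGraph (ballFamily ρ)).dist p q) ≤
      2 ^ 7 * 2 ^ ((p'.2 : ℕ) + q'.2 + (horoballGraph (ballFamily ρ')).dist p' q') := by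
    linarith
  rw [← pow_add, hp, hq] at h4
  have h5 := (pow_le_pow_iff_right₀ (one_lt_two (α := ℝ))).1 h4
  exact_mod_cast (by omega : (horoballGraph (ballFamily ρ)).dist p q ≤
    (horoballGraph (ballFamily ρ')).dist p' q' + 7)

/-- This is the logarithm of the Ptolemy inequality: the four heights enter each of the three
pairings with the same sum. The constant comes from 32² · 4² · 4² = 2^18. -/
theorem IsPseudoDist.fourPoint (hρ : IsPseudoDist ρ) [Nonempty V] (a b c d : V × ℕ+) :
    ((horoballGraph (ballFamily ρ)).dist a c : ℝ) + (horoballGraph (ballFamily ρ)).dist b d ≤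
      max (((horoballGraph (ballFamily ρ)).dist a b : ℝ) + (horoballGraph (ballFamily ρ)).dist c d)
        (((horoballGraph (ballFamily ρ)).dist a d : ℝ) + (horoballGraph (ballFamily ρ)).dist b c)
        + 18 := by
  set D := (horoballGraph (ballFamily ρ)).dist
  have pos := scale_pos (ρ := ρ)
  have key : ∀ p q r s : V × ℕ+, (p.2 : ℕ) + q.2 + (r.2 + s.2) = a.2 + b.2 + (c.2 + d.2) →
      scale ρ a c * scale ρ b d ≤ 4 * (scale ρ p q * scale ρ r s) →
      D a c + D b d ≤ D p q + D r s + 18 := by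
    intro p q r s hs h
    have h1 := mul_le_mul (hρ.two_pow_dist_le a c) (hρ.two_pow_dist_le b d) (by positivity)
      (by positivity)
    have h2 := mul_le_mul (hρ.scale_sq_le p q) (hρ.scale_sq_le r s) (by positivity)
      (by positivity)
    have h3 : (scale ρ a c * scale ρ b d) ^ 2 ≤ (4 * (scale ρ p q * scale ρ r s)) ^ 2 := by
      have := (mul_pos (pos a c) (pos b d)).le
      gcongr
    have h4 : (2 : ℝ) ^ ((a.2 : ℕ) + c.2 + D a c) * 2 ^ ((b.2 : ℕ) + d.2 + D b d) ≤
        2 ^ 18 * (2 ^ ((p.2 : ℕ) + q.2 + D p q) * 2 ^ ((r.2 : ℕ) + s.2 + D r s)) := by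
      linarith
    rw [← pow_add, ← pow_add, ← pow_add] at h4
    have := (pow_le_pow_iff_right₀ (one_lt_two (α := ℝ))).1 h4
    omega
  have h := hρ.scale_ptolemy a b c d
  rcases max_choice (scale ρ a b * scale ρ c d) (scale ρ a d * scale ρ b c) with h1 | h1 <;>
    rw [h1] at h
  · have h2 : ((D a c + D b d : ℕ) : ℝ) ≤ (D a b + D c d + 18 : ℕ) := by
      exact_mod_cast key a b c d rfl h
    push_cast at h2
    have := le_max_left ((D a b : ℝ) + D c d) ((D a d : ℝ) + D b c)
    linarith
  · have h2 : ((D a c + D b d : ℕ) : ℝ) ≤ (D a d + D b c + 18 : ℕ) := by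
      exact_mod_cast key a d b c (by omega) h
    push_cast at h2
    have := le_max_right ((D a b : ℝ) + D c d) ((D a d : ℝ) + D b c)
    linarith

end BallFamily

/-! ### A metric comparable to the exponential of the displacement -/

/-- Two uses of `hmul` across a chain of three steps cost 2C, hence a factor 2 after exponentiating.
This is the hypothesis of the chain metrization `PseudoMetricSpace.ofPreNNDist`, which then loses at
most a factor 2; invariance holds because translations permute chains. -/
theorem exists_exponential_pseudoDist {G : Type*} [Group G] {l : G → ℝ} {C : ℝ} (hC : 0 < C)
    (h0 : ∀ g, 0 ≤ l g) (h1 : l 1 = 0) (hinv : ∀ g, l g⁻¹ = l g)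
    (hmul : ∀ g k, l (g * k) ≤ max (l g) (l k) + C) :
    ∃ ρ : G → G → ℝ, IsPseudoDist ρ ∧ (∀ g a b, ρ (g * a) (g * b) = ρ a b) ∧
      ∀ a b, a ≠ b → ρ a b ≤ 2 ^ (l (a⁻¹ * b) / (2 * C)) ∧
        2 ^ (l (a⁻¹ * b) / (2 * C)) ≤ 2 * ρ a b := by
  classical
  -- The metrization needs 0 on the diagonal, where the exponential would give 1.
  set d : G → G → NNReal := fun a b => if a = b then 0 else 2 ^ (l (a⁻¹ * b) / (2 * C)) with hd
  have hne : ∀ a b, a ≠ b → d a b = 2 ^ (l (a⁻¹ * b) / (2 * C)) := fun a b h => if_neg h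
  have hself : ∀ a, d a a = 0 := fun a => if_pos rfl
  have hcomm : ∀ a b, d a b = d b a := by
    intro a b
    by_cases h : a = b
    · rw [h]
    · rw [hne a b h, hne b a (Ne.symm h), ← hinv, mul_inv_rev, inv_inv]
  have hsmul : ∀ g a b, d (g * a) (g * b) = d a b := by
    intro g a b
    simp only [hd, mul_right_inj]
    rw [show (g * a)⁻¹ * (g * b) = a⁻¹ * b by group]
  have hone : ∀ a b, a ≠ b → 1 ≤ d a b := by
    intro a b h
    rw [hne a b h]
    exact NNReal.one_le_rpow one_le_two (by have := h0 (a⁻¹ * b); positivity)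
  have hquad : ∀ x₁ x₂ x₃ x₄, d x₁ x₄ ≤ 2 * max (d x₁ x₂) (max (d x₂ x₃) (d x₃ x₄)) := by
    intro x₁ x₂ x₃ x₄
    by_cases h14 : x₁ = x₄
    · rw [h14, hself]
      exact zero_le
    set M := max (d x₁ x₂) (max (d x₂ x₃) (d x₃ x₄)) with hM
    have hM1 : d x₁ x₂ ≤ M := le_max_left _ _
    have hM2 : d x₂ x₃ ≤ M := (le_max_left _ _).trans (le_max_right _ _)
    have hM3 : d x₃ x₄ ≤ M := (le_max_right _ _).trans (le_max_right _ _)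
    -- Since x₁ ≠ x₄, some consecutive pair is distinct; this absorbs the degenerate pairs, where
    -- `d` is 0 but the exponential is 1.
    have hM0 : 1 ≤ M := by
      by_cases h12 : x₁ = x₂
      · by_cases h23 : x₂ = x₃
        · exact (hone x₃ x₄ (by rw [← h23, ← h12]; exact h14)).trans hM3
        · exact (hone _ _ h23).trans hM2
      · exact (hone _ _ h12).trans hM1
    have hstep : ∀ a b, d a b ≤ M → (2 : NNReal) ^ (l (a⁻¹ * b) / (2 * C)) ≤ M := by
      intro a b hab
      by_cases h : a = b
      · rw [h, inv_mul_cancel, h1, zero_div, NNReal.rpow_zero]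
        exact hM0
      · rwa [← hne a b h]
    have hle : ∀ r, l (x₁⁻¹ * x₄) ≤ r + 2 * C → (2 : NNReal) ^ (r / (2 * C)) ≤ M →
        d x₁ x₄ ≤ 2 * M := by
      intro r hr hrM
      rw [hne _ _ h14]
      calc (2 : NNReal) ^ (l (x₁⁻¹ * x₄) / (2 * C)) ≤ 2 ^ (1 + r / (2 * C)) := by
            refine NNReal.rpow_le_rpow_of_exponent_le one_le_two ?_
            rw [div_le_iff₀ (by positivity), add_mul, div_mul_cancel₀ _ (by positivity)]
            linarith
        _ = 2 * 2 ^ (r / (2 * C)) := by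
            rw [NNReal.rpow_add two_ne_zero, NNReal.rpow_one]
        _ ≤ 2 * M := by gcongr
    have a1 := hmul (x₁⁻¹ * x₂) (x₂⁻¹ * x₄)
    have a2 := hmul (x₂⁻¹ * x₃) (x₃⁻¹ * x₄)
    rw [mul_assoc, mul_inv_cancel_left] at a1 a2
    rcases max_choice (l (x₁⁻¹ * x₂)) (l (x₂⁻¹ * x₄)) with h | h <;> rw [h] at a1
    · exact hle _ (by linarith) (hstep _ _ hM1)
    · rcases max_choice (l (x₂⁻¹ * x₃)) (l (x₃⁻¹ * x₄)) with h | h <;> rw [h] at a2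
      · exact hle _ (by linarith) (hstep _ _ hM2)
      · exact hle _ (by linarith) (hstep _ _ hM3)
  let I := PseudoMetricSpace.ofPreNNDist d hself hcomm
  refine ⟨I.dist, ⟨I.dist_self, I.dist_comm, I.dist_triangle⟩, fun g a b => ?_,
    fun a b hab => ⟨?_, ?_⟩⟩
  · refine (PseudoMetricSpace.dist_ofPreNNDist d hself hcomm _ _).trans
      (Eq.trans ?_ (PseudoMetricSpace.dist_ofPreNNDist d hself hcomm _ _).symm)
    congr 1
    symm
    refine (List.map_surjective_iff.2 (Group.mulLeft_bijective g).surjective).iInf_congr _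
      fun s => ?_
    have e1 : (g * a) :: List.map (g * ·) s = List.map (g * ·) (a :: s) := rfl
    have e2 : List.map (g * ·) s ++ [g * b] = List.map (g * ·) (s ++ [b]) := by simp
    rw [e1, e2, List.zipWith_map]
    simp only [hsmul]
  · refine (PseudoMetricSpace.dist_ofPreNNDist_le d hself hcomm a b).trans_eq ?_
    rw [hne a b hab]
    push_cast
    rfl
  · refine Eq.trans_le ?_
      (PseudoMetricSpace.le_two_mul_dist_ofPreNNDist d hself hcomm hquad a b)
    rw [hne a b hab]
    push_cast
    rfl

/-! ### Horoballs of invariant pseudometrics -/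

section Cusp

variable {G : Type u} [Group G]

theorem smul_mem_ballFamily {V : Type*} [MulAction G V] {ρ : V → V → ℝ}
    (hinv : ∀ (g : G) v w, ρ (g • v) (g • w) = ρ v w) (g : G) (n : ℕ+) {v w : V}
    (h : v ∈ ballFamily ρ n w) : g • v ∈ ballFamily ρ n (g • w) := by
  change ρ _ _ ≤ _
  rw [hinv]
  exact h

/-- The radii start at 1 and double, so exponential growth is the triangle inequality. -/
theorem IsPseudoDist.admissible {Y : GGraph G} {ρ : Y.vert → Y.vert → ℝ} (hρ : IsPseudoDist ρ)
    (hinv : ∀ (g : G) v w, ρ (g • v) (g • w) = ρ v w)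
    (hY : ∀ v w, Y.graph.dist v w ≤ 1 ↔ ρ v w ≤ 1) : Admissible Y (ballFamily ρ) where
  connectedness v := by
    ext w
    change ρ v w ≤ _ ↔ Y.graph.dist v w ≤ 1
    rw [hY]
    norm_num
  exponential_growth n v w hv u hu := by
    change ρ _ _ ≤ _ at hv hu
    change ρ _ _ ≤ 2 ^ ((n : ℕ) + 1) / 2
    rw [pow_succ]
    linarith [hρ.triangle w v u]
  symmetry n v w hv := by
    change ρ _ _ ≤ _ at hv
    change ρ _ _ ≤ _
    rwa [hρ.symm]
  equivariance n g w := by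
    ext v
    constructor
    · rintro ⟨v, hv, rfl⟩
      exact smul_mem_ballFamily hinv g n hv
    · intro hv
      refine ⟨g⁻¹ • v, ?_, smul_inv_smul g v⟩
      simpa using smul_mem_ballFamily hinv g⁻¹ n hv

/-- The horoball graph of an invariant pseudometric on the group itself. -/
def cuspGraph {ρ : G → G → ℝ} (hρ : IsPseudoDist ρ)
    (hinv : ∀ g a b, ρ (g * a) (g * b) = ρ a b) : GGraph G where
  vert := G × ℕ+
  action :=
    { smul := fun g p => (g * p.1, p.2)
      one_smul := fun p => Prod.ext (one_mul p.1) rfl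
      mul_smul := fun g h p => Prod.ext (mul_assoc g h p.1) rfl }
  graph := horoballGraph (ballFamily ρ)
  connected := hρ.connected
  smul_adj g v w h := by
    rw [horoballGraph, SimpleGraph.fromRel_adj] at h ⊢
    have key : ∀ p q : G × ℕ+,
        (p.1 = q.1 ∧ q.2 = p.2 + 1) ∨ (p.2 = q.2 ∧ p.1 ∈ ballFamily ρ p.2 q.1) →
        (g * p.1 = g * q.1 ∧ q.2 = p.2 + 1) ∨
          (p.2 = q.2 ∧ g * p.1 ∈ ballFamily ρ p.2 (g * q.1)) :=
      fun p q hpq => hpq.imp (fun h => ⟨congrArg (g * ·) h.1, h.2⟩)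
        (fun h => ⟨h.1, smul_mem_ballFamily hinv g _ h.2⟩)
    exact ⟨fun he => h.1 (Prod.ext (mul_left_cancel (congrArg Prod.fst he))
      (congrArg Prod.snd he :)), h.2.imp (key v w) (key w v)⟩

variable {ρ : G → G → ℝ} (hρ : IsPseudoDist ρ) (hinv : ∀ g a b, ρ (g * a) (g * b) = ρ a b)

/-- The realization of `cuspGraph`. -/
noncomputable def cusp : HypGSpace G where
  toGSpace := (cuspGraph hρ hinv).realization
  isHyperbolic := GGraph.isHyperbolic_realization (by norm_num : (0 : ℝ) ≤ 18) hρ.fourPoint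

/-- Sending (g, n) to `g • c n` is strictly equivariant on vertices, so only distances remain to be
checked. -/
theorem cusp_coarselyEmbeds {X : HypGSpace G} (c : ℕ+ → X.carrier) {K C : ℝ} (hK : 1 ≤ K)
    (hC : 0 ≤ C)
    (hl : ∀ g h n m, K⁻¹ * (horoballGraph (ballFamily ρ)).dist (g, n) (h, m) - C ≤
      dist (g • c n) (h • c m))
    (hu : ∀ g h n m, dist (g • c n) (h • c m) ≤
      K * (horoballGraph (ballFamily ρ)).dist (g, n) (h, m) + C) :
    CoarselyEmbeds (cusp hρ hinv) X :=
  GGraph.coarselyEmbeds_of_vertices (Y := cuspGraph hρ hinv) (cusp hρ hinv).isHyperbolic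
    (fun p : G × ℕ+ => p.1 • c p.2) hK hC (fun v w => hl v.1 w.1 v.2 w.2)
    (fun v w => hu v.1 w.1 v.2 w.2) (fun g v => mul_smul g v.1 (c v.2))

/-! ### Connected graphs containing a given pseudometric on the group -/

/-- The functions on `G` at bounded distance from the function `ρ 1`. -/
def BoundedFunctions (ρ : G → G → ℝ) : Type u :=
  {f : G → ℝ // ∃ R, ∀ k, |f k - ρ 1 k| ≤ R}

/-- The supremum distance. -/
noncomputable def supDist (f f' : BoundedFunctions ρ) : ℝ := ⨆ k, |f.1 k - f'.1 k|

theorem supDist_le_iff (f f' : BoundedFunctions ρ) (r : ℝ) :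
    supDist f f' ≤ r ↔ ∀ k, |f.1 k - f'.1 k| ≤ r := by
  obtain ⟨R, hR⟩ := f.2
  obtain ⟨R', hR'⟩ := f'.2
  refine ciSup_le_iff ⟨R + R', ?_⟩
  rintro _ ⟨k, rfl⟩
  have h1 := abs_le.1 (hR k)
  have h2 := abs_le.1 (hR' k)
  exact abs_le.2 ⟨by linarith, by linarith⟩

theorem isPseudoDist_supDist : IsPseudoDist (supDist (ρ := ρ)) where
  self f := by simp [supDist]
  symm f f' := by simp only [supDist, abs_sub_comm]
  triangle f f' f'' := by
    rw [supDist_le_iff]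
    intro k
    exact (abs_sub_le _ (f'.1 k) _).trans
      (add_le_add ((supDist_le_iff f f' _).1 le_rfl k) ((supDist_le_iff f' f'' _).1 le_rfl k))

include hρ hinv

/-- The action by translation. -/
@[reducible] def boundedFunctionsAction : MulAction G (BoundedFunctions ρ) where
  smul g f := ⟨fun k => f.1 (g⁻¹ * k), by
    obtain ⟨R, hR⟩ := f.2
    -- By invariance the translate of ρ 1 is ρ g, which differs from ρ 1 by at most ρ(g, 1).
    refine ⟨R + ρ g 1, fun k => (_root_.abs_sub_le _ (ρ 1 (g⁻¹ * k)) _).trans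
      (add_le_add (hR _) ?_)⟩
    have h := hinv g 1 (g⁻¹ * k)
    rw [mul_inv_cancel_left, mul_one] at h
    rw [← h]
    exact hρ.abs_sub_le g 1 k⟩
  one_smul f := Subtype.ext (funext fun k => congrArg f.1 (by simp))
  mul_smul g h f := Subtype.ext (funext fun k => congrArg f.1 (by simp [mul_assoc]))

theorem supDist_smul_smul (g : G) (f f' : BoundedFunctions ρ) :
    letI := boundedFunctionsAction hρ hinv
    supDist (g • f) (g • f') = supDist f f' :=
  (Group.mulLeft_bijective g⁻¹).surjective.iSup_comp (fun k => |f.1 k - f'.1 k|)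

omit hρ hinv in
-- Convexity: moving 1/(n+1) of the way along the segment from f to f' is a step of length at most 1
-- that leaves distance at most n. This is what G with ρ may lack.
theorem supDist_connected :
    (SimpleGraph.fromRel fun f f' : BoundedFunctions ρ => supDist f f' ≤ 1).Connected := by
  have : Nonempty (BoundedFunctions ρ) := ⟨⟨ρ 1, 0, by simp⟩⟩
  have step : ∀ f f' : BoundedFunctions ρ, supDist f f' ≤ 1 →
      (SimpleGraph.fromRel fun f f' : BoundedFunctions ρ => supDist f f' ≤ 1).Reachable f f' := by
    intro f f' h
    by_cases hff : f = f'
    · rw [hff]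
    · refine SimpleGraph.Adj.reachable ?_
      rw [SimpleGraph.fromRel_adj]
      exact ⟨hff, Or.inl h⟩
  have key : ∀ (n : ℕ) (f f' : BoundedFunctions ρ), supDist f f' ≤ n →
      (SimpleGraph.fromRel fun f f' : BoundedFunctions ρ => supDist f f' ≤ 1).Reachable f f' := by
    intro n
    induction n with
    | zero => exact fun f f' h => step f f' (h.trans (by norm_num))
    | succ n ih =>
      intro f f' h
      rw [supDist_le_iff] at h
      push_cast at h
      have hn : (0 : ℝ) < n + 1 := by positivity
      let m : BoundedFunctions ρ := ⟨fun k => f.1 k + (f'.1 k - f.1 k) / (n + 1), by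
        obtain ⟨R, hR⟩ := f.2
        refine ⟨R + 1, fun k => ?_⟩
        have h1 : |(f'.1 k - f.1 k) / (n + 1)| ≤ 1 := by
          rw [abs_div, abs_of_pos hn, div_le_one hn, abs_sub_comm]
          exact h k
        rw [add_sub_right_comm]
        exact (abs_add_le _ _).trans (add_le_add (hR k) h1)⟩
      refine (step f m ?_).trans (ih m f' ?_)
      · rw [supDist_le_iff]
        intro k
        change |f.1 k - (f.1 k + (f'.1 k - f.1 k) / (n + 1))| ≤ 1
        rw [sub_add_cancel_left, abs_neg, abs_div, abs_of_pos hn, div_le_one hn, abs_sub_comm]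
        exact h k
      · rw [supDist_le_iff]
        intro k
        change |f.1 k + (f'.1 k - f.1 k) / (n + 1) - f'.1 k| ≤ n
        have e : f.1 k + (f'.1 k - f.1 k) / (n + 1) - f'.1 k =
            (f.1 k - f'.1 k) * (n / (n + 1)) := by
          field_simp
          ring
        rw [e, abs_mul, abs_of_nonneg (by positivity : (0 : ℝ) ≤ n / (n + 1))]
        calc |f.1 k - f'.1 k| * (n / (n + 1)) ≤ (n + 1) * (n / (n + 1)) := by
              gcongr
              exact h k
          _ = n := by field_simp
  refine ⟨fun f f' => ?_⟩
  obtain ⟨n, hn⟩ := exists_nat_ge (supDist f f')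
  exact key n f f' hn

/-- The graph on `BoundedFunctions ρ` whose edges join functions at distance at most one. -/
noncomputable def boundedFunctionsGraph : GGraph G where
  vert := BoundedFunctions ρ
  action := boundedFunctionsAction hρ hinv
  graph := SimpleGraph.fromRel fun f f' => supDist f f' ≤ 1
  connected := supDist_connected
  smul_adj g f f' h := by
    let _ := boundedFunctionsAction hρ hinv
    rw [SimpleGraph.fromRel_adj] at h ⊢
    rw [supDist_smul_smul hρ hinv, supDist_smul_smul hρ hinv]
    exact ⟨fun he => h.1 (smul_left_cancel g he), h.2⟩

omit hρ hinv in
theorem dist_le_one_iff_supDist_le_one (f f' : BoundedFunctions ρ) :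
    (SimpleGraph.fromRel fun f f' : BoundedFunctions ρ => supDist f f' ≤ 1).dist f f' ≤ 1 ↔
      supDist f f' ≤ 1 := by
  by_cases hff : f = f'
  · rw [hff, SimpleGraph.dist_self, isPseudoDist_supDist.self]
    simp
  · have h0 := fun h => hff ((supDist_connected (ρ := ρ)).dist_eq_zero_iff.1 h)
    rw [Nat.le_one_iff_eq_zero_or_eq_one, or_iff_right h0, SimpleGraph.dist_eq_one_iff_adj,
      SimpleGraph.fromRel_adj, isPseudoDist_supDist.symm f' f, or_self]
    exact and_iff_right hff

theorem admissible_supDist :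
    Admissible (boundedFunctionsGraph hρ hinv) (ballFamily (supDist (ρ := ρ))) :=
  IsPseudoDist.admissible (Y := boundedFunctionsGraph hρ hinv) isPseudoDist_supDist
    (supDist_smul_smul hρ hinv) dist_le_one_iff_supDist_le_one

/-- The combinatorial horoball based on `boundedFunctionsGraph`. -/
noncomputable def boundedFunctionsHoroball : HypGSpace G where
  toGSpace := (horoball _ _ (admissible_supDist hρ hinv)).realization
  isHyperbolic := by
    have : Nonempty (BoundedFunctions ρ) := supDist_connected.nonempty
    exact GGraph.isHyperbolic_realization (by norm_num : (0 : ℝ) ≤ 18)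
      isPseudoDist_supDist.fourPoint

/-- The Kuratowski embedding. -/
def kuratowski (g : G) : BoundedFunctions ρ :=
  ⟨ρ g, ρ g 1, fun k => hρ.abs_sub_le g 1 k⟩

omit hinv in
theorem supDist_kuratowski (g h : G) : supDist (kuratowski hρ g) (kuratowski hρ h) = ρ g h := by
  refine le_antisymm ((supDist_le_iff _ _ _).2 fun k => hρ.abs_sub_le g h k) ?_
  have h1 := (supDist_le_iff (kuratowski hρ g) (kuratowski hρ h) _).1 le_rfl h
  change |ρ g h - ρ h h| ≤ _ at h1
  rw [hρ.self, sub_zero] at h1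
  exact (le_abs_self _).trans h1

/-- The Kuratowski embedding preserves ρ, hence scales, hence horoball distances up to 7; left
invariance of ρ makes it equivariant. -/
theorem cusp_coarselyEmbeds_horoball :
    CoarselyEmbeds (cusp hρ hinv) (boundedFunctionsHoroball hρ hinv) := by
  have hne : Nonempty (BoundedFunctions ρ) := supDist_connected.nonempty
  have hp := isPseudoDist_supDist (ρ := ρ)
  let _ := boundedFunctionsAction hρ hinv
  have hk : ∀ g, kuratowski hρ g = g • kuratowski hρ 1 := by
    intro g
    refine Subtype.ext (funext fun k => ?_)
    change ρ g k = ρ 1 (g⁻¹ * k)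
    rw [← hinv g 1, mul_one, mul_inv_cancel_left]
  set A := admissible_supDist hρ hinv
  have hd : ∀ g h n m, dist (g • horoballPoint A (kuratowski hρ 1, n))
      (h • horoballPoint A (kuratowski hρ 1, m)) =
      (horoballGraph (ballFamily (supDist (ρ := ρ)))).dist (kuratowski hρ g, n)
        (kuratowski hρ h, m) := by
    intro g h n m
    rw [hk g, hk h]
    exact dist_horoballPoint A (g • kuratowski hρ 1, n) (h • kuratowski hρ 1, m)
  have hscale : ∀ g h n m, scale supDist (kuratowski hρ g, n) (kuratowski hρ h, m) =
      scale ρ (g, n) (h, m) := by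
    intro g h n m
    simp only [scale, supDist_kuratowski]
  refine cusp_coarselyEmbeds hρ hinv (X := boundedFunctionsHoroball hρ hinv)
    (fun n => horoballPoint A (kuratowski hρ 1, n)) (K := 1) (C := 7) le_rfl (by norm_num) ?_ ?_
  · intro g h n m
    refine le_of_le_of_eq ?_ (hd g h n m).symm
    have := hρ.dist_le_of_scale_le hp (p := (g, n)) (q := (h, m)) (p' := (kuratowski hρ g, n))
      (q' := (kuratowski hρ h, m)) rfl rfl (hscale g h n m).ge
    rw [inv_one, one_mul]
    linarith
  · intro g h n m
    refine (hd g h n m).trans_le ?_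
    have := hp.dist_le_of_scale_le hρ (p' := (g, n)) (q' := (h, m)) (p := (kuratowski hρ g, n))
      (q := (kuratowski hρ h, m)) rfl rfl (hscale g h n m).le
    linarith

end Cusp

/-! ### Coarse rays towards the fixed boundary point -/

section Ray

variable {G X : Type*} [Group G] [MetricSpace X] [MulAction G X] [IsIsometricSMul G X] {δ C : ℝ}
  {x : X}

/-- The points `c n` form a coarse ray issuing from `x`, towards the limit of the orbit. -/
theorem exists_coarse_ray (hX : FourPoint X δ) (hg : IsGeodesicSpace X) (hC0 : 0 ≤ C)
    (hC : ∀ g k : G, displacement x (g * k) ≤ max (displacement x g) (displacement x k) + C)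
    (hx : ∀ R : ℝ, ∃ g : G, R < displacement x g) :
    ∃ c : ℕ+ → X, (∀ n, dist x (c n) = C * n) ∧
      ∀ (n : ℕ+) (u : G), 2 * (C * n) + C ≤ displacement x u →
        dist (c n) (u • x) ≤ displacement x u - C * n + 2 * δ := by
  have key : ∀ n : ℕ+, ∃ a : X, dist x a = C * n ∧ ∀ u : G, 2 * (C * n) + C ≤ displacement x u →
      dist a (u • x) ≤ displacement x u - C * n + 2 * δ := by
    intro n
    -- The point is taken on a geodesic towards one far orbit point. For every other far u the
    -- product of hx and ux at x is at least Cn, so the point is also nearly on the way to ux.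
    obtain ⟨h, hh⟩ := hx (2 * (C * n) + C)
    obtain ⟨c, hc⟩ := hg x (h • x)
    have hn : 0 ≤ C * (n : ℝ) := by positivity
    have hd : dist x (h • x) = displacement x h := rfl
    have hm : C * (n : ℝ) ∈ Set.Icc 0 (dist x (h • x)) := ⟨hn, by rw [hd]; linarith⟩
    have h1 := hc.dist_left hm
    have h2 := hc.dist_right hm
    rw [hd] at h2
    refine ⟨c (C * n), by rw [dist_comm, h1], fun u hu => ?_⟩
    have h3 : gromovProduct (c (C * n)) (h • x) x = C * n := by
      rw [gromovProduct, h1, h2, dist_comm, hd]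
      ring
    have h4 := le_gromovProduct_orbit hC hh.le hu
    have h5 := hX.min_le (c (C * n)) (h • x) (u • x) x
    rw [h3, min_eq_left h4, gromovProduct, h1, dist_comm (u • x) x] at h5
    change _ ≤ dist x (u • x) - _ + _
    linarith
  choose c h1 h2 using key
  exact ⟨c, h1, h2⟩

/-- The rays from x and hx to the common limit merge after a length of about |h|/2. Before merging
the distance is about |h| - Cn - Cm, afterwards |Cn - Cm|; the maximum combines the cases. -/
theorem abs_dist_coarse_ray_le (hX : FourPoint X δ) (hδ : 0 ≤ δ) (hC0 : 0 ≤ C)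
    (hC : ∀ g k : G, displacement x (g * k) ≤ max (displacement x g) (displacement x k) + C)
    (hx : ∀ R : ℝ, ∃ g : G, R < displacement x g) {c : ℕ+ → X} (hc : ∀ n, dist x (c n) = C * n)
    (hc' : ∀ (n : ℕ+) (u : G), 2 * (C * n) + C ≤ displacement x u →
        dist (c n) (u • x) ≤ displacement x u - C * n + 2 * δ) (h : G) (n m : ℕ+) :
    |dist (c n) (h • c m) - (max (displacement x h) (max (2 * (C * n)) (2 * (C * m)))
      - C * n - C * m)| ≤ 3 * C + 8 * δ := by
  have hn : 0 ≤ C * (n : ℝ) := by positivity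
  have hm : 0 ≤ C * (m : ℝ) := by positivity
  have hD := displacement_nonneg x h
  set T := max (displacement x h) (max (2 * (C * n)) (2 * (C * m))) with hT
  have hT1 : displacement x h ≤ T := le_max_left _ _
  have hT2 : 2 * (C * n) ≤ T := (le_max_left _ _).trans (le_max_right _ _)
  have hT3 : 2 * (C * m) ≤ T := (le_max_right _ _).trans (le_max_right _ _)
  -- A far orbit point ux stands in for the boundary point; it must be far from hx as well, where
  -- |h⁻¹u| = |u| up to C.
  obtain ⟨u, hu⟩ := hx (displacement x h + 2 * (C * n) + 2 * (C * m) + 2 * C)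
  have hU1 : displacement x (h⁻¹ * u) ≤ displacement x u + C := by
    have := hC h⁻¹ u
    rwa [displacement_inv, max_eq_right (by linarith)] at this
  have hU2 : displacement x u ≤ displacement x (h⁻¹ * u) + C := by
    have := hC h (h⁻¹ * u)
    rw [mul_inv_cancel_left] at this
    rcases max_choice (displacement x h) (displacement x (h⁻¹ * u)) with h1 | h1 <;>
      rw [h1] at this <;> linarith
  have a1 := hc' n u (by linarith)
  have b1 := hc' m (h⁻¹ * u) (by linarith)
  have a2 : displacement x u ≤ C * n + dist (c n) (u • x) := by
    rw [← hc n]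
    exact dist_triangle _ _ _
  have b2 : displacement x (h⁻¹ * u) ≤ C * m + dist (c m) ((h⁻¹ * u) • x) := by
    rw [← hc m]
    exact dist_triangle _ _ _
  have e1 : dist (c m) ((h⁻¹ * u) • x) = dist (h • c m) (u • x) := by
    rw [← dist_smul h (c m), mul_smul, smul_inv_smul]
  have e2 : dist (h • x) (u • x) = displacement x (h⁻¹ * u) := dist_smul_smul_eq x h u
  have e3 : dist x (u • x) = displacement x u := rfl
  have e4 : dist x (h • x) = displacement x h := rfl
  have e5 : dist (h • x) (h • c m) = C * m := by rw [dist_smul, hc]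
  rw [e1] at b1 b2
  rw [abs_le]
  constructor
  · have l1 := dist_triangle (c n) (h • c m) (u • x)
    have l2 := dist_triangle_left (h • c m) (u • x) (c n)
    have l3 := dist_triangle4 x (c n) (h • c m) (h • x)
    rw [hc, e4, dist_comm (h • c m) (h • x), e5] at l3
    rcases max_choice (displacement x h) (max (2 * (C * n)) (2 * (C * m))) with h1 | h1
    · rw [hT, h1]
      linarith
    · rcases max_choice (2 * (C * (n : ℝ))) (2 * (C * m)) with h2 | h2
      · rw [hT, h1, h2]
        linarith
      · rw [hT, h1, h2]
        linarith
  -- Based at ux, the consecutive products along c n, x, hx, h c m are all at least |u| - T/2 - C,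
  -- so the product of the two ends loses only 2δ.
  · have g1 := hX.min_le (c n) x (h • c m) (u • x)
    have g2 := hX.min_le x (h • x) (h • c m) (u • x)
    have p1 : displacement x u - T / 2 - C ≤ gromovProduct (c n) x (u • x) := by
      rw [gromovProduct, e3, dist_comm (c n) x, hc]
      linarith
    have p2 : displacement x u - T / 2 - C ≤ gromovProduct x (h • x) (u • x) := by
      rw [gromovProduct, e2, e3, e4]
      linarith
    have p3 : displacement x u - T / 2 - C ≤ gromovProduct (h • x) (h • c m) (u • x) := by
      rw [gromovProduct, e2, e5]
      linarith
    have p4 := le_min p2 p3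
    have p5 : displacement x u - T / 2 - C - δ ≤
        min (gromovProduct (c n) x (u • x)) (gromovProduct x (h • c m) (u • x)) :=
      le_min (by linarith) (by linarith)
    have p6 : gromovProduct (c n) (h • c m) (u • x) =
        (dist (c n) (u • x) + dist (h • c m) (u • x) - dist (c n) (h • c m)) / 2 := rfl
    linarith

end Ray

/-! ### The construction of an invariant horoball -/

section Construction

variable {G : Type u} [Group G]

/-- Distances in the cusp, in terms of the function defining the pseudometric. -/
theorem abs_cusp_dist_le {ρ : G → G → ℝ} (hρ : IsPseudoDist ρ) {l : G → ℝ} {C : ℝ} (hC : 0 < C)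
    (h1 : l 1 = 0)
    (hl : ∀ a b, a ≠ b → ρ a b ≤ 2 ^ (l (a⁻¹ * b) / (2 * C)) ∧
      2 ^ (l (a⁻¹ * b) / (2 * C)) ≤ 2 * ρ a b) (g h : G) (n m : ℕ+) :
    |C * (horoballGraph (ballFamily ρ)).dist (g, n) (h, m) -
      (max (l (g⁻¹ * h)) (max (2 * (C * n)) (2 * (C * m))) - C * n - C * m)| ≤ 5 * C := by
  set L := (horoballGraph (ballFamily ρ)).dist (g, n) (h, m) with hL
  set S := scale ρ (g, n) (h, m) with hS
  -- t is log₂ of the scale S up to an error of 1: S ≤ 2^t ≤ 2S. For g = h, where ρ vanishes, the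
  -- heights already dominate.
  set t := max (l (g⁻¹ * h) / (2 * C)) (max (n : ℝ) m) with ht
  have hT : max (l (g⁻¹ * h)) (max (2 * (C * n)) (2 * (C * m))) = C * (2 * t) := by
    have h2C : (0 : ℝ) ≤ 2 * C := by positivity
    rw [show C * (2 * t) = 2 * C * t by ring, ht, mul_max_of_nonneg _ _ h2C,
      mul_max_of_nonneg _ _ h2C, mul_div_cancel₀ _ (by positivity)]
    congr 1
    ring_nf
  have t1 : l (g⁻¹ * h) / (2 * C) ≤ t := le_max_left _ _
  have t2 : (n : ℝ) ≤ t := (le_max_left _ _).trans (le_max_right _ _)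
  have t3 : (m : ℝ) ≤ t := (le_max_right _ _).trans (le_max_right _ _)
  have mono : ∀ {a b : ℝ}, a ≤ b → (2 : ℝ) ^ a ≤ 2 ^ b := fun h =>
    Real.rpow_le_rpow_of_exponent_le one_le_two h
  have s1 : ρ g h ≤ S := le_max_left _ _
  have s2 : (2 : ℝ) ^ (n : ℝ) ≤ S := by
    rw [Real.rpow_natCast]
    exact (le_max_left _ _).trans (le_max_right _ _)
  have s3 : (2 : ℝ) ^ (m : ℝ) ≤ S := by
    rw [Real.rpow_natCast]
    exact (le_max_right _ _).trans (le_max_right _ _)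
  have hS0 : 0 < S := scale_pos _ _
  have up : S ≤ 2 ^ t := by
    refine max_le ?_ (max_le ?_ ?_)
    · by_cases hgh : g = h
      · change ρ g h ≤ _
        rw [hgh, hρ.self]
        positivity
      · exact (hl g h hgh).1.trans (mono t1)
    · rw [← Real.rpow_natCast]
      exact mono t2
    · rw [← Real.rpow_natCast]
      exact mono t3
  have low : (2 : ℝ) ^ t ≤ 2 * S := by
    rcases max_choice (l (g⁻¹ * h) / (2 * C)) (max (n : ℝ) m) with h2 | h2
    · rw [ht, h2]
      by_cases hgh : g = h
      · rw [hgh, inv_mul_cancel, h1, zero_div, Real.rpow_zero]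
        have : (2 : ℝ) ^ (0 : ℝ) ≤ 2 ^ (n : ℝ) := mono (Nat.cast_nonneg _)
        rw [Real.rpow_zero] at this
        linarith
      · linarith [(hl g h hgh).2]
    · rcases max_choice (n : ℝ) m with h3 | h3 <;> rw [ht, h2, h3] <;> linarith
  have d1 : (2 : ℝ) ^ ((n : ℕ) + m + L) ≤ 32 * S ^ 2 := hρ.two_pow_dist_le (g, n) (h, m)
  have d2 : S ^ 2 ≤ 4 * 2 ^ ((n : ℕ) + m + L) := hρ.scale_sq_le (g, n) (h, m)
  have hsq : ((2 : ℝ) ^ t) ^ 2 = 2 ^ (2 * t) := by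
    rw [mul_comm, Real.rpow_mul (by norm_num)]
    norm_cast
  have u1 : (2 : ℝ) ^ ((n + m + L : ℕ) : ℝ) ≤ 2 ^ (2 * t + 5) := by
    rw [Real.rpow_natCast, Real.rpow_add two_pos, ← hsq]
    have : S ^ 2 ≤ ((2 : ℝ) ^ t) ^ 2 := by gcongr
    norm_num
    linarith
  have u2 : (2 : ℝ) ^ (2 * t) ≤ 2 ^ (((n + m + L : ℕ) : ℝ) + 4) := by
    rw [Real.rpow_add two_pos, Real.rpow_natCast, ← hsq]
    have : ((2 : ℝ) ^ t) ^ 2 ≤ (2 * S) ^ 2 := by gcongr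
    norm_num
    linarith
  have v1 := (Real.rpow_le_rpow_left_iff one_lt_two).1 u1
  have v2 := (Real.rpow_le_rpow_left_iff one_lt_two).1 u2
  push_cast at v1 v2
  have w1 := mul_le_mul_of_nonneg_left v1 hC.le
  have w2 := mul_le_mul_of_nonneg_left v2 hC.le
  rw [hT, abs_le]
  constructor <;> linarith

/-- It suffices to compare X with the cusp over (G, ρ), which embeds in an admissible horoball.
Taking C ≥ 1 lets it serve as the multiplicative constant. -/
theorem hasInvariantHoroball_of_not_actsHyperbolically (X : HypGSpace G)
    (h : ∀ g : G, ¬ ActsHyperbolically X g) : HasInvariantHoroball X := by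
  obtain ⟨x⟩ := X.isHyperbolic.1
  obtain ⟨C, hC1, hC⟩ : ∃ C ≥ (1 : ℝ), ∀ g k : G,
      displacement x (g * k) ≤ max (displacement x g) (displacement x k) + C := by
    obtain ⟨C, -, hC⟩ := X.exists_displacement_mul_le_max x h
    exact ⟨max C 1, le_max_right _ _, fun g k =>
      (hC g k).trans (add_le_add le_rfl (le_max_left _ _))⟩
  have hC0 : 0 < C := by linarith
  obtain ⟨ρ, hρ, hinv, hl⟩ := exists_exponential_pseudoDist hC0 (displacement_nonneg (G := G) x)
    (displacement_one x) (displacement_inv x) hC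
  have hcusp := abs_cusp_dist_le hρ hC0 (displacement_one x) hl
  suffices hXW : Equivalent X (cusp hρ hinv) from
    ⟨_, _, admissible_supDist hρ hinv, (boundedFunctionsHoroball hρ hinv).isHyperbolic,
      hXW.trans _ _ _ (.rel _ _ (cusp_coarselyEmbeds_horoball hρ hinv))⟩
  by_cases hb : ∃ R : ℝ, ∀ g : G, displacement x g ≤ R
  · obtain ⟨R, hR⟩ := hb
    -- With bounded orbits there is no ray, but the cusp has bounded orbits at height 1 too, so a
    -- point embeds in both.
    refine .trans _ (point G) _ (.symm _ _ (.rel _ _ (point_coarselyEmbeds x hR))) (.rel _ _ ?_)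
    refine point_coarselyEmbeds (X := cusp hρ hinv)
      (GGraph.vertex (cuspGraph hρ hinv) ((1, 1) : G × ℕ+)) (R := (R + 7 * C) / C) fun g => ?_
    have e : displacement (X := (cusp hρ hinv).carrier)
        (GGraph.vertex (cuspGraph hρ hinv) ((1, 1) : G × ℕ+)) g =
        (horoballGraph (ballFamily ρ)).dist (1, 1) (g * 1, 1) :=
      GGraph.dist_vertex_vertex (Y := cuspGraph hρ hinv) ((1, 1) : G × ℕ+) ((g * 1, 1) : G × ℕ+)
    rw [e, le_div_iff₀ hC0]
    have h1 := (abs_le.1 (hcusp 1 (g * 1) 1 1)).2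
    rw [inv_one, one_mul, mul_one, max_self] at h1
    rw [mul_one]
    have h2 : max (displacement x g) (2 * (C * ((1 : ℕ+) : ℕ))) ≤ R + 2 * C := by
      have := hR g
      have := displacement_nonneg x g
      refine max_le (by linarith) ?_
      simp only [PNat.one_coe, Nat.cast_one]
      linarith
    simp only [PNat.one_coe, Nat.cast_one] at h1 h2
    linarith
  · push Not at hb
    obtain ⟨δ, hδ, hX⟩ := X.exists_fourPoint
    obtain ⟨c, hc, hc'⟩ := exists_coarse_ray hX X.isHyperbolic.2.1 hC0.le hC hb
    have hray := abs_dist_coarse_ray_le hX hδ.le hC0.le hC hb hc hc'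
    -- The cusp embeds in X, in general not onto a coarsely dense subset. The additive error is 5C
    -- from the cusp plus 3C + 8δ from the ray.
    refine .symm _ _ (.rel _ _ (cusp_coarselyEmbeds hρ hinv c (K := C) (C := 8 * C + 8 * δ) hC1
      (by positivity) ?_ ?_))
    all_goals
      intro g k n m
      have e : dist (g • c n) (k • c m) = dist (c n) ((g⁻¹ * k) • c m) := by
        rw [← dist_smul g (c n), mul_smul, smul_inv_smul]
      have h1 := abs_le.1 (hcusp g k n m)
      have h2 := abs_le.1 (hray (g⁻¹ * k) n m)
      rw [e]
    · have h3 : C⁻¹ ≤ C := (inv_le_one_of_one_le₀ hC1).trans hC1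
      have h4 := mul_le_mul_of_nonneg_right h3
        (Nat.cast_nonneg (α := ℝ) ((horoballGraph (ballFamily ρ)).dist (g, n) (k, m)))
      linarith
    · linarith

end Construction

end HoroEq

/-! ### Equivalence of the three conditions -/

theorem theoremt {G : Type u} [Group G] (X : HoroEq.HypGSpace G) :
    List.TFAE
      [HoroEq.HasInvariantHoroball X,
        HoroEq.IsElementary X ∧ ∀ g : G, ¬ HoroEq.ActsHyperbolically X g,
        ∃ Y : HoroEq.HypGSpace G, HoroEq.Equivalent X Y ∧
          Subsingleton (HoroEq.Boundary Y.carrier)] := by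
  tfae_have 1 → 3 := fun ⟨_, _, hB, hH, h⟩ =>
    ⟨_, h, HoroEq.subsingleton_boundary_horoball hB hH⟩
  tfae_have 3 → 2 := fun ⟨_, h, hY⟩ =>
    have hX := HoroEq.not_actsHyperbolically_of_subsingleton_boundary h hY
    ⟨HoroEq.isElementary_of_not_actsHyperbolically X hX, hX⟩
  tfae_have 2 → 1 := fun h => HoroEq.hasInvariantHoroball_of_not_actsHyperbolically X h.2
  tfae_finish
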